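/- **Theorem 1.2.** Let $n\ge 1$, $D_t=-i\partial_t$, $D_{x}=-i\partial_{x}$, and let $A(t,\xi)=\{a_{ij}(t,\xi)\}_{i,j=1}^m$, $t\in\mathbb R$, $\xi\in\mathbb R^n\setminus 0$, be a complex matrix symbol whose entries are continuous in $\xi\neq 0$, positively homogeneous of order one in $\xi$, and satisfy, for each $\xi\neq0$, $a_{ij}(\cdot,\xi)\in \mathrm{Lip}_{\mathrm{loc}}(\mathbb R)$ and $\partial_t a_{ij}(\cdot,\xi)\in L^1(\mathbb R)$, with $$\sup_{|\xi|=1}\int_{\mathbb R}|\partial_t a_{ij}(t,\xi)|\,dt<\infty .$$ Suppose that $D_t-A(t,D_x)$ is regularly hyperbolic: $\det(\tau I-A(t,\xi))=\prod_{j=1}^m(\tau-\varphi_j(t,\xi))$ with real roots $\varphi_j(t,\xi)$, numbered so as to be continuous in $t$, and $$\inf_{t\in\mathbb R,\,|\xi|=1,\,j\ne k}|\varphi_j(t,\xi)-\varphi_k(t,\xi)|>0 .$$ Fix a sign $\pm$. Suppose that $a_{ij}(t,\xi)\to a_{ij}^\pm(\xi)$ as $t\to\pm\infty$ for all $i,j$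 and all $\xi\ne 0$, and that $A_\pm(\xi)=\{a_{ij}^\pm(\xi)\}$ satisfies $\det(\tau I-A_\pm(\xi))=\prod_{j=1}^m(\tau-\varphi_j^\pm(\xi))$ with real $\varphi^\pm_j(\xi)$ and $\inf_{|\xi|=1,\,j\neq k}|\varphi_j^\pm(\xi)-\varphi_k^\pm(\xi)|>0$. Assume finally that for each $\xi\ne0$ and each $j$ the function $\varphi_j(\cdot,\xi)-\varphi_j^\pm(\xi)$ is integrable on $(0,+\infty)$ (resp. $(-\infty,0)$), in the sense that $\int_0^t(\varphi_j(s,\xi)-\varphi_j^\pm(\xi))\,ds$ has a finite limit as $t\to\pm\infty$. Then for any solution $V_\pm\in C(\mathbb R;(L^2(\mathbb R^n))^m)$ of $D_tV_\pm=A_\pm(D_x)V_\pm$, $\pm t>0$, there exists a unique solution $U\in C(\mathbb R;(L^2(\mathbb R^n))^m)$ of $D_tU=A(t,D_x)U$ on $\mathbb R$ such that $$\|V_\pm(t)-U(t)\|_{(L^2(\mathbb R^n))^m}\to0\qquad(t\to\pm\infty).$$ Moreover, every element of $(L^2(\mathbb R^n))^m$ is $V_\pm(0)$ for such a solution $V_\pm$,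 and the mapping (wave operator) $\mathscr W_\pm: V_\pm(0)\mapsto U(0)$ is a well-defined bounded linear operator on $(L^2(\mathbb R^n))^m$. Here the equations are understood in the sense of distributions, where $P(D_x)u$ is the tempered distribution whose Fourier transform (normalised with $e^{-ix\cdot\xi}$) is $P(\xi)\widehat u(\xi)$. -/

import Mathlib

open MeasureTheory Filter Topology Set
open scoped FourierTransform SchwartzMap

noncomputable section

/-- The space `ℝⁿ`. -/
abbrev Space (n : ℕ) : Type := EuclideanSpace ℝ (Fin n)

/-- The Hilbert space `(L²(ℝⁿ))ᵐ`, realised as the square integrable functions with values in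
`ℂᵐ`; the norm is `(∑ⱼ ‖fⱼ‖²)^(1/2)`. -/
abbrev L2Vec (n m : ℕ) : Type :=
  Lp (EuclideanSpace ℂ (Fin m)) 2 (volume : Measure (Space n))

/-- The two ends of the time axis, `t → +∞` and `t → -∞`. -/
inductive TimeEnd
  | plus
  | minus

/-- The limit `t → +∞`, respectively `t → -∞`. -/
def TimeEnd.limit : TimeEnd → Filter ℝ
  | .plus => atTop
  | .minus => atBot

/-- The open half line `±t > 0`. -/
def TimeEnd.halfLine : TimeEnd → Set ℝ
  | .plus => Ioi 0
  | .minus => Iio 0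

/-- First order symbols `A(t,ξ) = (a_ij(t,ξ))`: positively homogeneous of order one and continuous
in `ξ ≠ 0`, with `a_ij(·,ξ)` locally Lipschitz and `∂ₜ a_ij(·,ξ) ∈ L¹(ℝ)`, where the `L¹` norms
are bounded uniformly on the unit sphere `|ξ| = 1`. -/
structure IsAdmissibleSymbol {n m : ℕ}
    (A : ℝ → Space n → Matrix (Fin m) (Fin m) ℂ) : Prop where
  homogeneous : ∀ t : ℝ, ∀ c : ℝ, 0 < c → ∀ ξ : Space n, ξ ≠ 0 →
    A t (c • ξ) = (c : ℂ) • A t ξ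
  continuousOn : ∀ t : ℝ, ∀ i j, ContinuousOn (fun ξ => A t ξ i j) {0}ᶜ
  locallyLipschitz : ∀ ξ : Space n, ξ ≠ 0 → ∀ i j, LocallyLipschitz (fun t => A t ξ i j)
  integrable_deriv : ∀ ξ : Space n, ξ ≠ 0 → ∀ i j,
    Integrable (deriv (fun t => A t ξ i j)) volume
  bound : ∃ M : ℝ, ∀ ξ : Space n, ‖ξ‖ = 1 → ∀ i j,
    ∫ t, ‖deriv (fun s => A s ξ i j) t‖ ≤ M

/-- The operator `D_t - A(t,D_x)` is regularly hyperbolic with characteristic roots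
`φ₁(t,ξ), …, φₘ(t,ξ)`: these are real, `det (τ I - A(t,ξ)) = ∏ⱼ (τ - φⱼ(t,ξ))`, they are numbered
so as to be continuous in `t`, and they are uniformly separated on the unit sphere. -/
structure IsRegularlyHyperbolic {n m : ℕ}
    (A : ℝ → Space n → Matrix (Fin m) (Fin m) ℂ) (φ : Fin m → ℝ → Space n → ℝ) : Prop where
  charpoly_eq : ∀ t : ℝ, ∀ ξ : Space n, ξ ≠ 0 →
    (A t ξ).charpoly = ∏ j, (Polynomial.X - Polynomial.C ((φ j t ξ : ℝ) : ℂ))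
  continuous : ∀ j, ∀ ξ : Space n, ξ ≠ 0 → Continuous (fun t => φ j t ξ)
  separated : ∃ d : ℝ, 0 < d ∧ ∀ t : ℝ, ∀ ξ : Space n, ‖ξ‖ = 1 → ∀ j k, j ≠ k →
    d ≤ |φ j t ξ - φ k t ξ|

/-- The pairing `⟨P(D_x) u, χ⟩` of the tempered distribution `P(D_x) u`, `u ∈ (L²(ℝⁿ))ᵐ`, with a
scalar test function `χ`, where `D_x = -i ∂_x`. The Fourier transform `𝓕` is normalised with the
character `exp (-2π i x·ξ)`, so that `P(D_x) u` is the inverse Fourier transform of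
`P(2πξ) (𝓕 u)(ξ)`. -/
def symbolPairing {n m : ℕ} (P : Space n → Matrix (Fin m) (Fin m) ℂ) (u : L2Vec n m)
    (χ : 𝓢(Space n, ℂ)) : EuclideanSpace ℂ (Fin m) :=
  ∫ ξ : Space n, (𝓕⁻ χ) ξ • Matrix.toEuclideanLin (P ((2 * Real.pi) • ξ)) ((𝓕 u : L2Vec n m) ξ)

/-- `U` solves `D_t U = A(t,D_x) U`, that is `∂ₜ U = i A(t,D_x) U`, for `t` in the open set `J`, in
the sense of (tempered) distributions in `x`. -/
def IsSolutionOn {n m : ℕ} (J : Set ℝ) (A : ℝ → Space n → Matrix (Fin m) (Fin m) ℂ)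
    (U : ℝ → L2Vec n m) : Prop :=
  ∀ χ : 𝓢(Space n, ℂ), ∀ t ∈ J,
    HasDerivAt (fun s => ∫ x : Space n, χ x • (U s) x)
      (Complex.I • symbolPairing (A t) (U t) χ) t

end

/-!
# Wave operators for regularly hyperbolic first order systems

The Fourier transform turns `D_t U = A(t,D_x) U` into the family of ordinary differential equations
`∂ₜ w = i A(t,2πξ) w`, one for each frequency `ξ`, and the wave operator into multiplication by a
bounded matrix function of `ξ`.

At a fixed frequency let `Pⱼ(t)` be the spectral projections of the symbol. As the characteristic
roots are separated, the variation of `Pⱼ` is bounded by that of the symbol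
(`IsSpectralPath.norm_proj_sub_le`), which is finite. For a solution `Y`, the modes
`e^{-i ∫₀ᵗ φⱼ} Pⱼ(t) Y(t)` would be constant if the `Pⱼ` were; in general their increments are bounded
by `‖Y‖` times the variation of `Pⱼ` (`IsSpectralPath.eventually_norm_mode_sub_le`). Gronwall's
argument bounds `Y` in terms of its value at any other time (`IsSpectralPath.norm_le`), so that the
modes have finite variation and converge. Replacing the phase `∫₀ᵗ φⱼ` by `t φⱼ^±` costs the factor
`e^{i ∫₀ᵗ (φⱼ - φⱼ^±)}`, which converges by hypothesis; hence `e^{-i t A_±} Y(t)` has a limit `Ω`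
(`IsSpectralPath.exists_tendsto_spectralExp_mul_atTop`). By homogeneity the frequency enters only
through its direction and a factor `|ξ|` in front of the equation, of which all the bounds are
independent. Therefore `Y`, `Ω` and their inverses are bounded uniformly in `ξ`
(`IsAdmissibleSymbol.exists_isWavePair`).

The propagators are constructed by Dyson series, which makes them measurable in `ξ`. Multiplication
by them gives all solutions in `L²`: solutions in the sense of distributions are unique since on a
ball of frequencies the equation has bounded coefficients (`IsFreqSolutionOn.eq_zero`). Finally the
solution `U` asymptotic to `V` has `Û(0) = Ω⁻¹ V̂(0)`: pointwise convergence at each frequency becomes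
convergence in `L²` by dominated convergence (`exists_wave_multiplier`).
-/

/-! ### Increments bounded to first order -/

section Dini

/-- A continuous function whose upper right derivative is nowhere positive is nonincreasing. -/
theorem antitone_of_eventually_le_add {f : ℝ → ℝ} (hf : Continuous f)
    (h : ∀ s, ∀ ε > 0, ∀ᶠ t in 𝓝[>] s, f t ≤ f s + ε * (t - s)) : Antitone f := by
  intro a b hab
  refine image_le_of_liminf_slope_right_le_deriv_boundary (f := f) (B := fun _ => f a)
    (B' := fun _ => 0) hf.continuousOn le_rfl continuousOn_const
    (fun x _ => hasDerivWithinAt_const _ _ _) ?_ ⟨hab, le_rfl⟩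
  intro x _ r hr
  refine Eventually.frequently ?_
  filter_upwards [h x (r / 2) (by positivity), self_mem_nhdsWithin] with t ht hxt
  have hxt' : 0 < t - x := sub_pos.2 hxt
  rw [slope_def_field, div_lt_iff₀ hxt']
  nlinarith

/-- If the increments of `f` are locally bounded by those of `G`, up to an error of order
`o(t - s)`, then they are bounded by them globally. No differentiability of `f` or `G` is needed,
which is why paths of bounded variation can be treated without derivatives almost everywhere. -/
theorem norm_sub_le_of_eventually_le {F : Type*} [NormedAddCommGroup F] {f : ℝ → F} {G : ℝ → ℝ}
    (hf : Continuous f) (hG : Continuous G)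
    (h : ∀ s, ∀ ε > 0, ∀ᶠ t in 𝓝[>] s, ‖f t - f s‖ ≤ G t - G s + ε * (t - s))
    {a b : ℝ} (hab : a ≤ b) : ‖f b - f a‖ ≤ G b - G a := by
  have key := antitone_of_eventually_le_add (f := fun t => ‖f t - f a‖ - G t) (by fun_prop) (by
    intro s ε hε
    filter_upwards [h s ε hε] with t ht
    have := norm_sub_le_norm_sub_add_norm_sub (f t) (f s) (f a)
    linarith) hab
  simp only [sub_self, norm_zero, zero_sub] at key
  linarith

end Dini

/-! ### Spectral resolutions along a path of bounded variation -/

section Spectral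

variable {𝔸 ι : Type*} [NormedRing 𝔸] [NormedAlgebra ℂ 𝔸] [Fintype ι]

/-- The `P j` decompose the unit, and `b` acts on the range of `P j` from both sides as the scalar
`φ j`. For distinct `φ j` the `P j` are then the spectral projections of `b`. -/
structure IsSpectralResolution (b : 𝔸) (φ : ι → ℝ) (P : ι → 𝔸) : Prop where
  sum_eq_one : ∑ j, P j = 1
  mul_left : ∀ j, b * P j = (φ j : ℂ) • P j
  mul_right : ∀ j, P j * b = (φ j : ℂ) • P j

namespace IsSpectralResolution

variable {b b' : 𝔸} {φ φ' : ι → ℝ} {P P' : ι → 𝔸}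

/-- The identity behind all perturbation estimates: the spectral projections of `b` and `b'`
diagonalise the difference `b' - b`. -/
theorem mul_sub_mul (h : IsSpectralResolution b φ P) (h' : IsSpectralResolution b' φ' P')
    (k j : ι) : P k * (b' - b) * P' j = ((φ' j - φ k : ℝ) : ℂ) • (P k * P' j) := by
  rw [mul_sub, sub_mul, mul_assoc, h'.mul_left, h.mul_right, mul_smul_comm, smul_mul_assoc]
  push_cast
  rw [sub_smul]

theorem norm_mul_le_of_separated (h : IsSpectralResolution b φ P) (h' : IsSpectralResolution b' φ' P')
    {K δ : ℝ} (hδ : 0 < δ) {k j : ι} (hk : ‖P k‖ ≤ K) (hj : ‖P' j‖ ≤ K)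
    (hsep : δ ≤ |φ' j - φ k|) : ‖P k * P' j‖ ≤ K ^ 2 / δ * ‖b' - b‖ := by
  have hK : 0 ≤ K := (norm_nonneg _).trans hk
  have h1 : |φ' j - φ k| * ‖P k * P' j‖ ≤ K * ‖b' - b‖ * K := by
    calc |φ' j - φ k| * ‖P k * P' j‖ = ‖P k * (b' - b) * P' j‖ := by
          rw [h.mul_sub_mul h', norm_smul, Complex.norm_real, Real.norm_eq_abs]
      _ ≤ ‖P k‖ * ‖b' - b‖ * ‖P' j‖ :=
          (norm_mul_le _ _).trans (mul_le_mul_of_nonneg_right (norm_mul_le _ _) (norm_nonneg _))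
      _ ≤ _ := by gcongr
  have h2 : δ * ‖P k * P' j‖ ≤ K * ‖b' - b‖ * K :=
    (mul_le_mul_of_nonneg_right hsep (norm_nonneg _)).trans h1
  rw [div_mul_eq_mul_div, le_div_iff₀ hδ]
  linarith

theorem proj_mul_eq_zero (h : IsSpectralResolution b φ P) {j k : ι} (hjk : φ j ≠ φ k) :
    P k * P j = 0 := by
  have := h.mul_sub_mul h k j
  rw [sub_self, mul_zero, zero_mul, eq_comm, smul_eq_zero] at this
  exact this.resolve_left (by exact_mod_cast sub_ne_zero.2 hjk)

theorem proj_mul_self (h : IsSpectralResolution b φ P) (hφ : Function.Injective φ) (j : ι) :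
    P j * P j = P j := by
  classical
  calc P j * P j = P j * ∑ k, P k := by
        rw [Finset.mul_sum, Finset.sum_eq_single j (fun k _ hk => h.proj_mul_eq_zero (hφ.ne hk))
          (by simp)]
    _ = P j := by rw [h.sum_eq_one, mul_one]

/-- The projection `P' j` is close to `P j` when `b'` is close to `b`: writing the difference as
`∑ₖ (Pₖ P'ⱼ - Pⱼ P'ₖ)`, only the off-diagonal terms `k ≠ j` survive, and the diagonal term, which
would involve the variation of the eigenvalue, drops out. -/
theorem norm_proj_sub_le [DecidableEq ι] (h : IsSpectralResolution b φ P)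
    (h' : IsSpectralResolution b' φ' P')
    {K δ : ℝ} (hδ : 0 < δ) (hk : ∀ k, ‖P k‖ ≤ K) (hj : ∀ k, ‖P' k‖ ≤ K)
    (hsep : ∀ j k, j ≠ k → δ ≤ |φ' j - φ k|) (j : ι) :
    ‖P' j - P j‖ ≤ Fintype.card ι * (2 * (K ^ 2 / δ)) * ‖b' - b‖ := by
  have hK : 0 ≤ K := (norm_nonneg _).trans (hk j)
  have e : P' j - P j = ∑ k ∈ Finset.univ.erase j, (P k * P' j - P j * P' k) := by
    have e1 : ∑ k, (P k * P' j - P j * P' k) = P' j - P j := by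
      rw [Finset.sum_sub_distrib, ← Finset.sum_mul, ← Finset.mul_sum, h.sum_eq_one,
        h'.sum_eq_one, one_mul, mul_one]
    rw [← e1, ← Finset.add_sum_erase _ _ (Finset.mem_univ j), sub_self, zero_add]
  rw [e]
  have hb : ∀ k ∈ Finset.univ.erase j, ‖P k * P' j - P j * P' k‖
      ≤ 2 * (K ^ 2 / δ) * ‖b' - b‖ := by
    intro k hkj
    have hkj' : k ≠ j := Finset.ne_of_mem_erase hkj
    have h1 := h.norm_mul_le_of_separated h' hδ (hk k) (hj j) (hsep j k hkj'.symm)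
    have h2 := h.norm_mul_le_of_separated h' hδ (hk j) (hj k) (hsep k j hkj')
    have := norm_sub_le (P k * P' j) (P j * P' k)
    linarith
  refine (norm_sum_le_of_le _ hb).trans ?_
  have hcard : ((Finset.univ.erase j).card : ℝ) ≤ Fintype.card ι := by
    exact_mod_cast Finset.card_le_univ _
  rw [Finset.sum_const, nsmul_eq_mul, mul_assoc (Fintype.card ι : ℝ)]
  exact mul_le_mul_of_nonneg_right hcard (by positivity)

end IsSpectralResolution

/-- A path `b` with uniformly separated real eigenvalues `φ j`, continuous in `t`, and spectral
projections `P j` bounded by `K`. The variation of `b` is controlled by the increments of the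
continuous nondecreasing function `g`, of total oscillation at most `M`. -/
structure IsSpectralPath (b : ℝ → 𝔸) (φ : ι → ℝ → ℝ) (P : ι → ℝ → 𝔸) (g : ℝ → ℝ)
    (K d M : ℝ) : Prop where
  resolution : ∀ t, IsSpectralResolution (b t) (fun j => φ j t) (fun j => P j t)
  norm_proj_le : ∀ j t, ‖P j t‖ ≤ K
  pos : 0 < d
  separated : ∀ t j k, j ≠ k → d ≤ |φ j t - φ k t|
  continuous_root : ∀ j, Continuous (φ j)
  continuous_var : Continuous g
  monotone_var : Monotone g
  var_le : ∀ s t, g t - g s ≤ M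
  norm_sub_le : ∀ s t, ‖b t - b s‖ ≤ |g t - g s|

namespace IsSpectralPath

variable {b : ℝ → 𝔸} {φ : ι → ℝ → ℝ} {P : ι → ℝ → 𝔸} {g : ℝ → ℝ} {K d M : ℝ}

theorem continuous (h : IsSpectralPath b φ P g K d M) : Continuous b := by
  refine continuous_iff_continuousAt.2 fun s => ?_
  rw [ContinuousAt, tendsto_iff_norm_sub_tendsto_zero]
  refine squeeze_zero (fun _ => norm_nonneg _) (fun t => h.norm_sub_le s t) ?_
  have : Continuous fun t => |g t - g s| := by have := h.continuous_var; fun_prop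
  simpa using this.tendsto s

/-- Time reversal turns statements about `t → +∞` and forward estimates into statements about
`t → -∞` and backward estimates. -/
theorem reverse (h : IsSpectralPath b φ P g K d M) :
    IsSpectralPath (fun t => b (-t)) (fun j t => φ j (-t)) (fun j t => P j (-t))
      (fun t => - g (-t)) K d M where
  resolution t := h.resolution (-t)
  norm_proj_le j t := h.norm_proj_le j (-t)
  pos := h.pos
  separated t := h.separated (-t)
  continuous_root j := (h.continuous_root j).comp continuous_neg
  continuous_var := (h.continuous_var.comp continuous_neg).neg
  monotone_var s t hst := neg_le_neg (h.monotone_var (neg_le_neg hst))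
  var_le s t := by have := h.var_le (-t) (-s); linarith
  norm_sub_le s t := by
    have := h.norm_sub_le (-s) (-t)
    rwa [neg_sub_neg, abs_sub_comm]

/-- The Lipschitz constant of the spectral projections with respect to the variation `g`. -/
noncomputable def projConst (ι : Type*) [Fintype ι] (K d : ℝ) : ℝ :=
  Fintype.card ι * (2 * (K ^ 2 / (d / 2)))

theorem projConst_nonneg {K d : ℝ} (hd : 0 < d) : 0 ≤ projConst ι K d := by
  unfold projConst; positivity

theorem eventually_norm_proj_sub_le (h : IsSpectralPath b φ P g K d M) (j : ι) (s : ℝ) :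
    ∀ᶠ t in 𝓝 s, ‖P j t - P j s‖ ≤ projConst ι K d * |g t - g s| := by
  classical
  have hφ : ∀ᶠ t in 𝓝 s, ∀ k, |φ k t - φ k s| < d / 2 := by
    refine eventually_all.2 fun k => ?_
    have := Metric.tendsto_nhds.1 ((h.continuous_root k).tendsto s) (d / 2) (half_pos h.pos)
    simpa [Real.dist_eq] using this
  filter_upwards [hφ] with t ht
  have hC : 0 ≤ projConst ι K d := projConst_nonneg h.pos
  refine ((h.resolution s).norm_proj_sub_le (h.resolution t) (half_pos h.pos)
    (fun k => h.norm_proj_le k s) (fun k => h.norm_proj_le k t) ?_ j).trans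
    (mul_le_mul_of_nonneg_left (h.norm_sub_le s t) hC)
  intro i k hik
  have h1 := h.separated s i k hik
  have h2 := abs_sub_abs_le_abs_sub (φ i s - φ k s) (φ i s - φ i t)
  have h3 : φ i s - φ k s - (φ i s - φ i t) = φ i t - φ k s := by ring
  rw [h3, abs_sub_comm (φ i s) (φ i t)] at h2
  linarith [ht i]

theorem continuous_proj (h : IsSpectralPath b φ P g K d M) (j : ι) : Continuous (P j) := by
  refine continuous_iff_continuousAt.2 fun s => ?_
  rw [ContinuousAt, tendsto_iff_norm_sub_tendsto_zero]
  refine squeeze_zero' (Eventually.of_forall fun _ => norm_nonneg _)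
    (h.eventually_norm_proj_sub_le j s) ?_
  have : Continuous fun t => projConst ι K d * |g t - g s| := by
    have := h.continuous_var; fun_prop
  simpa using this.tendsto s

theorem norm_proj_sub_le (h : IsSpectralPath b φ P g K d M) (j : ι) {s t : ℝ} (hst : s ≤ t) :
    ‖P j t - P j s‖ ≤ projConst ι K d * (g t - g s) := by
  have := norm_sub_le_of_eventually_le (h.continuous_proj j)
    (G := fun t => projConst ι K d * g t) (continuous_const.mul h.continuous_var) (by
      intro x ε hε
      filter_upwards [nhdsWithin_le_nhds (h.eventually_norm_proj_sub_le j x),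
        self_mem_nhdsWithin] with y hy hxy
      have hxy' : x < y := hxy
      rw [abs_of_nonneg (sub_nonneg.2 (h.monotone_var hxy'.le))] at hy
      have : 0 ≤ ε * (y - x) := mul_nonneg hε.le (sub_nonneg.2 hxy'.le)
      linarith) hst
  linarith

/-- The component `Pⱼ(t) Y(t)` of a solution of `Y' = i r b Y`, with its oscillation removed:
`e^{-i r ∫₀ᵗ φⱼ} Pⱼ(t) Y(t)`. -/
noncomputable def mode (φ : ι → ℝ → ℝ) (P : ι → ℝ → 𝔸) (r : ℝ) (Y : ℝ → 𝔸) (j : ι) (t : ℝ) : 𝔸 :=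
  Complex.exp (-(Complex.I * ((r * ∫ s in (0 : ℝ)..t, φ j s : ℝ) : ℂ))) • (P j t * Y t)

theorem norm_exp_neg_I_mul (x : ℝ) : ‖Complex.exp (-(Complex.I * (x : ℂ)))‖ = 1 := by
  rw [Complex.norm_exp]; simp

theorem norm_mode {ι : Type*} {φ : ι → ℝ → ℝ} {P : ι → ℝ → 𝔸} (r : ℝ) (Y : ℝ → 𝔸) (j : ι) (t : ℝ) :
    ‖mode φ P r Y j t‖ = ‖P j t * Y t‖ := by
  rw [mode, norm_smul, norm_exp_neg_I_mul, one_mul]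

theorem continuous_mode (h : IsSpectralPath b φ P g K d M) (r : ℝ) {Y : ℝ → 𝔸}
    (hY : Continuous Y) (j : ι) : Continuous (mode φ P r Y j) := by
  have h1 : Continuous fun t => ∫ s in (0 : ℝ)..t, φ j s :=
    intervalIntegral.continuous_primitive
      (fun a b => (h.continuous_root j).intervalIntegrable a b) 0
  have h2 := h.continuous_proj j
  unfold mode
  fun_prop

/-- To first order the modes move only through the variation of the projections: if `Pⱼ` were
constant, the phase factor would cancel the derivative of `Pⱼ Y` exactly. The bound does not involve
`r`, hence is uniform in the size of the frequency. -/
theorem eventually_norm_mode_sub_le (h : IsSpectralPath b φ P g K d M) {r : ℝ} {Y : ℝ → 𝔸}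
    (hY : ∀ t, HasDerivAt Y ((Complex.I * (r : ℂ)) • (b t * Y t)) t) (j : ι) (s : ℝ)
    {ε : ℝ} (hε : 0 < ε) :
    ∀ᶠ t in 𝓝[>] s, ‖mode φ P r Y j t - mode φ P r Y j s‖ ≤
      projConst ι K d * (g t - g s) * ‖Y t‖ + ε * (t - s) := by
  set F : ℝ → ℝ := fun t => ∫ s in (0 : ℝ)..t, φ j s with hF
  set e : ℝ → ℂ := fun t => Complex.exp (-(Complex.I * ((r * F t : ℝ) : ℂ))) with he
  have hFd : HasDerivAt F (φ j s) s :=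
    ((h.continuous_root j).integral_hasStrictDerivAt 0 s).hasDerivAt
  have hed : HasDerivAt e (e s * -(Complex.I * ((r * φ j s : ℝ) : ℂ))) s :=
    (((hFd.const_mul r).ofReal_comp).const_mul Complex.I).neg.cexp
  have hd : HasDerivAt (fun t => e t • (P j s * Y t)) 0 s := by
    have := hed.smul ((hY s).const_mul (P j s))
    convert! this using 1
    rw [mul_smul_comm, ← mul_assoc, (h.resolution s).mul_right, smul_mul_assoc, smul_smul,
      smul_smul, ← add_smul]
    push_cast
    ring_nf
    simp
  have ho := (hd.isLittleO.def hε)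
  filter_upwards [nhdsWithin_le_nhds (h.eventually_norm_proj_sub_le j s), self_mem_nhdsWithin,
    nhdsWithin_le_nhds ho] with t ht hst hot
  have hst' : s < t := hst
  rw [abs_of_nonneg (sub_nonneg.2 (h.monotone_var hst'.le))] at ht
  rw [smul_zero, sub_zero, Real.norm_of_nonneg (sub_nonneg.2 hst'.le)] at hot
  have e1 : mode φ P r Y j t - mode φ P r Y j s =
      e t • ((P j t - P j s) * Y t) + (e t • (P j s * Y t) - e s • (P j s * Y s)) := by
    rw [sub_mul, smul_sub]
    simp only [mode, he, hF]
    abel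
  rw [e1]
  refine (norm_add_le _ _).trans (add_le_add ?_ hot)
  rw [norm_smul, he, norm_exp_neg_I_mul, one_mul]
  exact (norm_mul_le _ _).trans (mul_le_mul_of_nonneg_right ht (norm_nonneg _))

theorem norm_le_sum_mode (h : IsSpectralPath b φ P g K d M) (r : ℝ) (Y : ℝ → 𝔸) (t : ℝ) :
    ‖Y t‖ ≤ ∑ j, ‖mode φ P r Y j t‖ := by
  simp only [norm_mode]
  calc ‖Y t‖ = ‖∑ j, P j t * Y t‖ := by
        rw [← Finset.sum_mul, (h.resolution t).sum_eq_one, one_mul]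
    _ ≤ _ := norm_sum_le _ _

theorem sum_mode_le (h : IsSpectralPath b φ P g K d M) (r : ℝ) (Y : ℝ → 𝔸) (t : ℝ) :
    ∑ j, ‖mode φ P r Y j t‖ ≤ Fintype.card ι * K * ‖Y t‖ := by
  simp only [norm_mode]
  calc ∑ j, ‖P j t * Y t‖ ≤ ∑ _j : ι, K * ‖Y t‖ := Finset.sum_le_sum fun j _ =>
        (norm_mul_le _ _).trans (mul_le_mul_of_nonneg_right (h.norm_proj_le j t) (norm_nonneg _))
    _ = _ := by rw [Finset.sum_const, nsmul_eq_mul, Finset.card_univ, mul_assoc]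

/-- The constant of the energy estimate `norm_le`, uniform in `r` and in time. -/
noncomputable def energyConst (ι : Type*) [Fintype ι] (K d M : ℝ) : ℝ :=
  Fintype.card ι * K * Real.exp ((Fintype.card ι * projConst ι K d + 1) * M)

/-- The energy estimate forward in time: `(∑ⱼ ‖modeⱼ‖ + δ) e^{-κ g}` is nonincreasing for a suitable
`κ`. -/
theorem norm_le_of_le (h : IsSpectralPath b φ P g K d M) {r : ℝ} {Y : ℝ → 𝔸}
    (hY : ∀ t, HasDerivAt Y ((Complex.I * (r : ℂ)) • (b t * Y t)) t) {s t : ℝ} (hst : s ≤ t) :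
    ‖Y t‖ ≤ energyConst ι K d M * ‖Y s‖ := by
  have hYc : Continuous Y := continuous_iff_continuousAt.2 fun t => (hY t).continuousAt
  set S : ℝ → ℝ := fun t => ∑ j, ‖mode φ P r Y j t‖ with hS
  have hSc : Continuous S :=
    continuous_finsetSum _ fun j _ => (h.continuous_mode r hYc j).norm
  have hS0 : ∀ t, 0 ≤ S t := fun t => Finset.sum_nonneg fun _ _ => norm_nonneg _
  set N : ℝ := (Fintype.card ι : ℝ) with hN
  set C : ℝ := N * projConst ι K d with hC
  have hN0 : 0 ≤ N := by positivity
  have hC0 : 0 ≤ C := mul_nonneg hN0 (projConst_nonneg h.pos)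
  -- The energy grows at most at the rate of the variation `g`, to first order.
  have hSloc : ∀ x, ∀ ε > 0, ∀ᶠ y in 𝓝[>] x,
      S y - S x ≤ C * (g y - g x) * S y + ε * (y - x) := by
    intro x ε hε
    have hε' : 0 < ε / (N + 1) := by positivity
    filter_upwards [eventually_all.2 fun j => h.eventually_norm_mode_sub_le hY j x hε',
      self_mem_nhdsWithin] with y hy hxy
    have hxy' : x < y := hxy
    have hg : 0 ≤ g y - g x := sub_nonneg.2 (h.monotone_var hxy'.le)
    calc S y - S x = ∑ j, (‖mode φ P r Y j y‖ - ‖mode φ P r Y j x‖) := by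
          rw [Finset.sum_sub_distrib]
      _ ≤ ∑ _j : ι, (projConst ι K d * (g y - g x) * S y + ε / (N + 1) * (y - x)) := by
          refine Finset.sum_le_sum fun j _ => (norm_sub_norm_le _ _).trans ((hy j).trans ?_)
          gcongr
          · exact mul_nonneg (projConst_nonneg h.pos) hg
          · exact h.norm_le_sum_mode r Y y
      _ = C * (g y - g x) * S y + N * (ε / (N + 1)) * (y - x) := by
          rw [Finset.sum_const, nsmul_eq_mul, Finset.card_univ]; ring
      _ ≤ _ := by
          have : N * (ε / (N + 1)) ≤ ε := by
            rw [mul_div_assoc', div_le_iff₀ (by positivity)]; nlinarith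
          exact add_le_add_right (mul_le_mul_of_nonneg_right this (sub_nonneg.2 hxy'.le)) _
  -- Adding `δ > 0` keeps the logarithmic derivative of the energy meaningful at its zeros.
  have hmain : ∀ δ > 0, S t + δ ≤ (S s + δ) * Real.exp ((C + 1) * M) := by
    intro δ hδ
    have hanti : Antitone fun y => (S y + δ) * Real.exp (-((C + 1) * g y)) := by
      refine antitone_of_eventually_le_add ?_ ?_
      · have := h.continuous_var; fun_prop
      intro x ε hε
      set q : ℝ := Real.exp (-((C + 1) * g x)) with hq
      have hq0 : 0 < q := Real.exp_pos _
      have hnear : ∀ᶠ y in 𝓝 x, C * (S y + δ) < (C + 1) * (S x + δ) := by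
        refine Tendsto.eventually_lt_const (v := C * (S x + δ)) ?_ ?_
        · nlinarith [hS0 x]
        · exact (continuous_const.mul (hSc.add continuous_const)).tendsto x
      filter_upwards [hSloc x (ε / q) (by positivity), self_mem_nhdsWithin,
        nhdsWithin_le_nhds hnear] with y hy hxy hn
      have hxy' : x < y := hxy
      have hg : 0 ≤ g y - g x := sub_nonneg.2 (h.monotone_var hxy'.le)
      set Δ : ℝ := (C + 1) * (g y - g x) with hΔ
      have hΔ0 : 0 ≤ Δ := by positivity
      have e1 : Real.exp (-((C + 1) * g y)) = q * Real.exp (-Δ) := by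
        rw [hq, ← Real.exp_add]; congr 1; rw [hΔ]; ring
      have h1 : S y + δ ≤ (S x + δ) * (1 + Δ) + ε / q * (y - x) := by
        have : C * (g y - g x) * S y ≤ (g y - g x) * ((C + 1) * (S x + δ)) := by
          have : C * S y ≤ (C + 1) * (S x + δ) := by nlinarith
          calc C * (g y - g x) * S y = (g y - g x) * (C * S y) := by ring
            _ ≤ _ := by gcongr
        rw [hΔ]; nlinarith
      have h2 : 1 + Δ ≤ Real.exp Δ := by linarith [Real.add_one_le_exp Δ]
      have h3 : Real.exp (-Δ) ≤ 1 := Real.exp_le_one_iff.2 (by linarith)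
      have h4 : Real.exp Δ * Real.exp (-Δ) = 1 := by rw [← Real.exp_add]; simp
      have hSx : 0 < S x + δ := by linarith [hS0 x]
      have hεy : 0 ≤ ε / q * (y - x) := mul_nonneg (by positivity) (sub_nonneg.2 hxy'.le)
      calc (S y + δ) * Real.exp (-((C + 1) * g y))
          = q * ((S y + δ) * Real.exp (-Δ)) := by rw [e1]; ring
        _ ≤ q * (((S x + δ) * Real.exp Δ + ε / q * (y - x)) * Real.exp (-Δ)) := by
            refine mul_le_mul_of_nonneg_left (mul_le_mul_of_nonneg_right ?_
              (Real.exp_pos _).le) hq0.le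
            exact h1.trans (add_le_add_left (mul_le_mul_of_nonneg_left h2 hSx.le) _)
        _ = q * ((S x + δ) * (Real.exp Δ * Real.exp (-Δ))
              + ε / q * (y - x) * Real.exp (-Δ)) := by ring
        _ ≤ q * ((S x + δ) * 1 + ε / q * (y - x) * 1) := by
            rw [h4]; gcongr
        _ = (S x + δ) * q + ε * (y - x) := by field_simp
    have h5 : (S t + δ) * Real.exp (-((C + 1) * g t)) ≤
      (S s + δ) * Real.exp (-((C + 1) * g s)) := hanti hst
    have hSs : 0 < S s + δ := by linarith [hS0 s]
    calc S t + δ = (S t + δ) * Real.exp (-((C + 1) * g t)) * Real.exp ((C + 1) * g t) := by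
          rw [mul_assoc, ← Real.exp_add]; simp
      _ ≤ (S s + δ) * Real.exp (-((C + 1) * g s)) * Real.exp ((C + 1) * g t) := by gcongr
      _ = (S s + δ) * Real.exp ((C + 1) * (g t - g s)) := by
          rw [mul_assoc, ← Real.exp_add]; congr 2; ring
      _ ≤ _ := by
          gcongr
          exact h.var_le s t
  have hlim : S t ≤ S s * Real.exp ((C + 1) * M) := by
    have hl : Tendsto (fun δ : ℝ => S t + δ) (𝓝[>] 0) (𝓝 (S t)) := by
      have : Continuous fun δ : ℝ => S t + δ := by fun_prop
      simpa using (this.tendsto 0).mono_left nhdsWithin_le_nhds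
    have hr : Tendsto (fun δ : ℝ => (S s + δ) * Real.exp ((C + 1) * M)) (𝓝[>] 0)
        (𝓝 (S s * Real.exp ((C + 1) * M))) := by
      have : Continuous fun δ : ℝ => (S s + δ) * Real.exp ((C + 1) * M) := by fun_prop
      simpa using (this.tendsto 0).mono_left nhdsWithin_le_nhds
    exact le_of_tendsto_of_tendsto hl hr
      (by filter_upwards [self_mem_nhdsWithin] with δ hδ using hmain δ hδ)
  calc ‖Y t‖ ≤ S t := h.norm_le_sum_mode r Y t
    _ ≤ S s * Real.exp ((C + 1) * M) := hlim
    _ ≤ (N * K * ‖Y s‖) * Real.exp ((C + 1) * M) := by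
        gcongr; exact h.sum_mode_le r Y s
    _ = _ := by simp only [energyConst, ← hN, ← hC]; ring

theorem hasDerivAt_reverse {r : ℝ} {Y : ℝ → 𝔸}
    (hY : ∀ t, HasDerivAt Y ((Complex.I * (r : ℂ)) • (b t * Y t)) t) (t : ℝ) :
    HasDerivAt (fun t => Y (-t)) ((Complex.I * ((-r : ℝ) : ℂ)) • (b (-t) * Y (-t))) t := by
  have := (hY (-t)).scomp t (hasDerivAt_neg t)
  convert! this using 1
  push_cast
  rw [mul_neg, neg_smul, neg_smul, one_smul]

/-- The energy estimate: a solution at any two times has comparable norms. -/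
theorem norm_le (h : IsSpectralPath b φ P g K d M) {r : ℝ} {Y : ℝ → 𝔸}
    (hY : ∀ t, HasDerivAt Y ((Complex.I * (r : ℂ)) • (b t * Y t)) t) (s t : ℝ) :
    ‖Y t‖ ≤ energyConst ι K d M * ‖Y s‖ := by
  rcases le_total s t with hst | hst
  · exact h.norm_le_of_le hY hst
  · simpa using h.reverse.norm_le_of_le (hasDerivAt_reverse hY) (neg_le_neg hst)

end IsSpectralPath

end Spectral

/-! ### Limits at infinity and invertibility -/

section Limits

theorem exists_tendsto_atTop_of_norm_sub_le {F : Type*} [NormedAddCommGroup F] [CompleteSpace F]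
    {f : ℝ → F} {g : ℝ → ℝ} {C M : ℝ} (hC : 0 ≤ C) (hg : Monotone g) (hM : ∀ s t, g t - g s ≤ M)
    (h : ∀ s t, s ≤ t → ‖f t - f s‖ ≤ C * (g t - g s)) : ∃ l, Tendsto f atTop (𝓝 l) := by
  have hbdd : BddAbove (range g) := ⟨g 0 + M, by
    rintro _ ⟨t, rfl⟩
    linarith [hM 0 t]⟩
  set L : ℝ := ⨆ t, g t with hL
  have hgL : Tendsto g atTop (𝓝 L) := tendsto_atTop_ciSup hg hbdd
  have hle : ∀ t, g t ≤ L := fun t => le_ciSup hbdd t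
  have hdist : ∀ n m N : ℝ, N ≤ n → n ≤ m → dist (f n) (f m) ≤ C * (L - g N) := by
    intro n m N hn hnm
    rw [dist_comm, dist_eq_norm]
    refine (h n m hnm).trans (mul_le_mul_of_nonneg_left ?_ hC)
    linarith [hle m, hg hn]
  have hcs : CauchySeq f := by
    refine cauchySeq_of_le_tendsto_0 (fun N => C * (L - g N)) ?_ ?_
    · intro n m N hn hm
      rcases le_total n m with hnm | hnm
      · exact hdist n m N hn hnm
      · rw [dist_comm]; exact hdist m n N hm hnm
    · simpa using ((tendsto_const_nhds (x := L)).sub hgL).const_mul C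
  exact cauchySeq_tendsto_of_complete hcs

/-- If a continuous function has a limit at `+∞`, the only constant from which it can differ by a
conditionally integrable function is that limit. -/
theorem eq_of_tendsto_integral_sub {f : ℝ → ℝ} (hf : Continuous f) {l c θ : ℝ}
    (hl : Tendsto f atTop (𝓝 l))
    (hθ : Tendsto (fun t => ∫ s in (0 : ℝ)..t, (f s - c)) atTop (𝓝 θ)) : l = c := by
  set F : ℝ → ℝ := fun t => ∫ s in (0 : ℝ)..t, (f s - c) with hF
  have hc : Continuous fun s => f s - c := hf.sub continuous_const
  have hd : ∀ t, HasDerivAt F (f t - c) t := fun t =>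
    (hc.integral_hasStrictDerivAt 0 t).hasDerivAt
  -- By the mean value theorem `f - c` attains the increments of its convergent primitive.
  have hx : ∀ t : ℝ, ∃ x, t ≤ x ∧ f x - c = F (t + 1) - F t := by
    intro t
    obtain ⟨x, hx, hx'⟩ := exists_hasDerivAt_eq_slope F (fun t => f t - c) (lt_add_one t)
      (fun x _ => (hd x).continuousAt.continuousWithinAt) (fun x _ => hd x)
    exact ⟨x, hx.1.le, by simpa using hx'⟩
  choose x hx hx' using hx
  have h1 : Tendsto (fun t => f (x t) - c) atTop (𝓝 (l - c)) :=
    (hl.comp (tendsto_atTop_mono hx tendsto_id)).sub_const c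
  have h2 : Tendsto (fun t => F (t + 1) - F t) atTop (𝓝 (θ - θ)) :=
    (hθ.comp (tendsto_atTop_add_const_right _ 1 tendsto_id)).sub hθ
  have := tendsto_nhds_unique h1 (by simpa only [hx'] using h2)
  linarith

/-- In a finite-dimensional algebra, an element by which left multiplication is bounded below is
invertible. -/
theorem isUnit_of_norm_le {𝔸 : Type*} [NormedRing 𝔸] [NormedAlgebra ℂ 𝔸] [FiniteDimensional ℂ 𝔸]
    {a : 𝔸} {C : ℝ} (h : ∀ c, ‖c‖ ≤ C * ‖a * c‖) :
    IsUnit a ∧ ‖Ring.inverse a‖ ≤ C * ‖(1 : 𝔸)‖ := by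
  have hinj : Function.Injective (LinearMap.mulLeft ℂ a) := by
    rw [injective_iff_map_eq_zero]
    intro c hc
    have := h c
    rw [LinearMap.mulLeft_apply] at hc
    rw [hc, norm_zero, mul_zero] at this
    exact norm_le_zero_iff.1 this
  obtain ⟨c, hc⟩ := LinearMap.surjective_of_injective hinj 1
  have hac : a * c = 1 := hc
  have hca : c * a = 1 := hinj (by simp [← mul_assoc, hac])
  have hu : IsUnit a := ⟨⟨a, c, hac, hca⟩, rfl⟩
  refine ⟨hu, ?_⟩
  have := h (Ring.inverse a)
  rwa [Ring.mul_inverse_cancel a hu] at this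

end Limits

section WavePair

variable {𝔸 : Type*} [NormedRing 𝔸]

/-- The bounds satisfied by a propagator `Y` and a free propagator `Z` (both equal to `1` at time
`0`): they are bounded by `C` together with their inverses, and `Z(t)⁻¹ Y(t) = Z(-t) Y(t)` converges
at the end `e` of the time axis to an invertible element whose inverse is bounded by `C`. -/
structure IsWavePair (e : TimeEnd) (C : ℝ) (Y Z : ℝ → 𝔸) : Prop where
  norm_le : ∀ t, ‖Y t‖ ≤ C
  isUnit : ∀ t, IsUnit (Y t)
  norm_inverse_le : ∀ t, ‖Ring.inverse (Y t)‖ ≤ C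
  norm_free_le : ∀ t, ‖Z t‖ ≤ C
  free_mul_free_neg : ∀ t, Z t * Z (-t) = 1
  exists_limit : ∃ Ω, Tendsto (fun t => Z (-t) * Y t) e.limit (𝓝 Ω) ∧ IsUnit Ω ∧
    ‖Ring.inverse Ω‖ ≤ C

theorem IsWavePair.mono {e : TimeEnd} {C C' : ℝ} {Y Z : ℝ → 𝔸} (h : IsWavePair e C Y Z)
    (hC : C ≤ C') : IsWavePair e C' Y Z where
  norm_le t := (h.norm_le t).trans hC
  isUnit := h.isUnit
  norm_inverse_le t := (h.norm_inverse_le t).trans hC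
  norm_free_le t := (h.norm_free_le t).trans hC
  free_mul_free_neg := h.free_mul_free_neg
  exists_limit := by
    obtain ⟨Ω, h1, h2, h3⟩ := h.exists_limit
    exact ⟨Ω, h1, h2, h3.trans hC⟩

theorem isWavePair_one {e : TimeEnd} {C : ℝ} (hC : ‖(1 : 𝔸)‖ ≤ C) :
    IsWavePair e C (fun _ : ℝ => (1 : 𝔸)) (fun _ => 1) where
  norm_le _ := hC
  isUnit _ := isUnit_one
  norm_inverse_le _ := by rwa [Ring.inverse_one]
  norm_free_le _ := hC
  free_mul_free_neg _ := mul_one 1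
  exists_limit := ⟨1, by simpa using tendsto_const_nhds, isUnit_one, by rwa [Ring.inverse_one]⟩

end WavePair

/-! ### Asymptotics of the propagator at a fixed frequency -/

section Asymptotics

variable {𝔸 ι : Type*} [NormedRing 𝔸] [NormedAlgebra ℂ 𝔸] [Fintype ι]

/-- The group `e^{i t r b} = ∑ⱼ e^{i t r φⱼ} Qⱼ` generated by an element `b = ∑ⱼ φⱼ Qⱼ`. -/
noncomputable def spectralExp (φ : ι → ℝ) (Q : ι → 𝔸) (r t : ℝ) : 𝔸 :=
  ∑ j, Complex.exp (Complex.I * ((r * t * φ j : ℝ) : ℂ)) • Q j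

theorem norm_spectralExp_le {φ : ι → ℝ} {Q : ι → 𝔸} {K : ℝ} (hQ : ∀ j, ‖Q j‖ ≤ K) (r t : ℝ) :
    ‖spectralExp φ Q r t‖ ≤ Fintype.card ι * K := by
  refine (norm_sum_le_of_le _ (fun j _ => ?_)).trans_eq (by
    rw [Finset.sum_const, nsmul_eq_mul, Finset.card_univ])
  rw [norm_smul, Complex.norm_exp_I_mul_ofReal, one_mul]
  exact hQ j

theorem spectralExp_neg_neg (φ : ι → ℝ) (Q : ι → 𝔸) (r t : ℝ) :
    spectralExp φ Q (-r) (-t) = spectralExp φ Q r t := by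
  simp [spectralExp]

namespace IsSpectralResolution

variable {b : 𝔸} {φ : ι → ℝ} {Q : ι → 𝔸}

theorem spectralExp_zero (h : IsSpectralResolution b φ Q) (r : ℝ) :
    spectralExp φ Q r 0 = 1 := by
  simp [spectralExp, h.sum_eq_one]

theorem spectralExp_mul_spectralExp_neg (h : IsSpectralResolution b φ Q)
    (hφ : Function.Injective φ) (r t : ℝ) :
    spectralExp φ Q r t * spectralExp φ Q r (-t) = 1 := by
  classical
  rw [spectralExp, spectralExp, Finset.sum_mul_sum, ← h.sum_eq_one]
  refine Finset.sum_congr rfl fun j _ => ?_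
  rw [Finset.sum_eq_single j]
  · rw [smul_mul_smul_comm, h.proj_mul_self hφ, ← Complex.exp_add]
    have : Complex.I * ((r * t * φ j : ℝ) : ℂ) + Complex.I * ((r * -t * φ j : ℝ) : ℂ) = 0 := by
      push_cast; ring
    rw [this, Complex.exp_zero, one_smul]
  · intro k _ hk
    rw [smul_mul_smul_comm, h.proj_mul_eq_zero (hφ.ne hk), smul_zero]
  · simp

theorem hasDerivAt_spectralExp_neg (h : IsSpectralResolution b φ Q) (r t : ℝ) :
    HasDerivAt (fun t => spectralExp φ Q r (-t))
      (-((Complex.I * (r : ℂ)) • (spectralExp φ Q r (-t) * b))) t := by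
  unfold spectralExp
  rw [Finset.sum_mul, Finset.smul_sum, ← Finset.sum_neg_distrib]
  refine HasDerivAt.fun_sum fun j _ => ?_
  have h0 : HasDerivAt (fun t : ℝ => r * -t * φ j) (r * -1 * φ j) t :=
    (((hasDerivAt_neg t).const_mul r).mul_const (φ j))
  have h1 := ((h0.ofReal_comp).const_mul Complex.I).cexp.smul_const (Q j)
  convert! h1 using 1
  rw [smul_mul_assoc, h.mul_right, smul_smul, smul_smul, ← neg_smul]
  congr 1
  push_cast
  ring

/-- `spectralExp` is the only solution of `Z' = i r b Z` with `Z 0 = 1`. -/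
theorem eq_spectralExp (h : IsSpectralResolution b φ Q) (hφ : Function.Injective φ) {r : ℝ}
    {Z : ℝ → 𝔸} (hZ : ∀ t, HasDerivAt Z ((Complex.I * (r : ℂ)) • (b * Z t)) t) (hZ0 : Z 0 = 1)
    (t : ℝ) : Z t = spectralExp φ Q r t := by
  have hd : ∀ t, HasDerivAt (fun t => spectralExp φ Q r (-t) * Z t) 0 t := by
    intro t
    have := (h.hasDerivAt_spectralExp_neg r t).mul (hZ t)
    convert! this using 1
    rw [neg_mul, smul_mul_assoc, mul_smul_comm, mul_assoc, neg_add_cancel]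
  have hc := is_const_of_deriv_eq_zero (fun t => (hd t).differentiableAt)
    (fun t => (hd t).deriv) t 0
  simp only [neg_zero, h.spectralExp_zero, hZ0, mul_one] at hc
  calc Z t = spectralExp φ Q r t * (spectralExp φ Q r (-t) * Z t) := by
        rw [← mul_assoc, h.spectralExp_mul_spectralExp_neg hφ, one_mul]
    _ = _ := by rw [hc, mul_one]

end IsSpectralResolution

namespace IsSpectralPath

variable {b : ℝ → 𝔸} {φ : ι → ℝ → ℝ} {P : ι → ℝ → 𝔸} {g : ℝ → ℝ} {K d M : ℝ}

/-- An eigenvalue converges as soon as its (nonzero) projection and the path converge: since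
`b Pⱼ = φⱼ Pⱼ`, it is a quotient of convergent scalars. -/
theorem exists_tendsto_root (h : IsSpectralPath b φ P g K d M) (hP : ∀ j t, P j t ≠ 0) {bl Q : 𝔸}
    (hb : Tendsto b atTop (𝓝 bl)) {j : ι} (hQ : Tendsto (P j) atTop (𝓝 Q)) :
    ∃ l, Tendsto (φ j) atTop (𝓝 l) := by
  -- A nonzero idempotent has norm at least `1`, so the limit projection does not vanish.
  have hone : ∀ t, 1 ≤ ‖P j t‖ := by
    intro t
    have hinj : Function.Injective fun j => φ j t := by
      intro i k hik
      by_contra hne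
      have := h.separated t i k hne
      have h0 : φ i t = φ k t := hik
      rw [h0, sub_self, abs_zero] at this
      linarith [h.pos]
    have h1 := norm_mul_le (P j t) (P j t)
    rw [(h.resolution t).proj_mul_self hinj] at h1
    have h2 : 0 < ‖P j t‖ := norm_pos_iff.2 (hP j t)
    nlinarith
  have hQ1 : 1 ≤ ‖Q‖ := ge_of_tendsto' hQ.norm hone
  have hQ0 : Q ≠ 0 := by
    rintro rfl
    rw [norm_zero] at hQ1
    linarith
  obtain ⟨f, -, hfQ⟩ := exists_dual_vector ℂ Q (norm_ne_zero_iff.2 hQ0)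
  have hfQ0 : f Q ≠ 0 := by
    rw [hfQ]; simpa using hQ0
  have h1 : Tendsto (fun t => f (P j t)) atTop (𝓝 (f Q)) := (f.continuous.tendsto Q).comp hQ
  have h2 : Tendsto (fun t => f (b t * P j t)) atTop (𝓝 (f (bl * Q))) :=
    (f.continuous.tendsto _).comp (hb.mul hQ)
  have h3 := (Complex.continuous_re.tendsto _).comp (h2.div h1 hfQ0)
  refine ⟨_, h3.congr' ?_⟩
  filter_upwards [h1.eventually_ne hfQ0] with t ht
  have := (h.resolution t).mul_left j
  simp only [Function.comp_apply, this, Pi.div_apply, map_smul, smul_eq_mul]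
  rw [mul_div_cancel_right₀ _ ht, Complex.ofReal_re]

variable [CompleteSpace 𝔸]

/-- The projections have limits at infinity, since their variation is finite, and the limits resolve
the limit `bl` of the path. The conditional integrability identifies the eigenvalue belonging to the
`j`-th limit projection as `φl j`. -/
theorem exists_tendsto_proj_atTop (h : IsSpectralPath b φ P g K d M) (hP : ∀ j t, P j t ≠ 0)
    {bl : 𝔸} {φl : ι → ℝ} (hb : Tendsto b atTop (𝓝 bl))
    (hint : ∀ j, ∃ θ, Tendsto (fun t => ∫ s in (0 : ℝ)..t, (φ j s - φl j)) atTop (𝓝 θ)) :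
    ∃ Q : ι → 𝔸, IsSpectralResolution bl φl Q ∧ (∀ j, ‖Q j‖ ≤ K) ∧
      ∀ j, Tendsto (P j) atTop (𝓝 (Q j)) := by
  choose Q hQ using fun j => exists_tendsto_atTop_of_norm_sub_le
    (projConst_nonneg (ι := ι) (K := K) h.pos)
    h.monotone_var h.var_le (fun s t hst => h.norm_proj_sub_le j hst)
  have hφ : ∀ j, Tendsto (φ j) atTop (𝓝 (φl j)) := by
    intro j
    obtain ⟨l, hl⟩ := h.exists_tendsto_root hP hb (hQ j)
    obtain ⟨θ, hθ⟩ := hint j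
    rwa [eq_of_tendsto_integral_sub (h.continuous_root j) hl hθ] at hl
  have hφ' : ∀ j, Tendsto (fun t => (φ j t : ℂ)) atTop (𝓝 (φl j : ℂ)) := fun j =>
    (Complex.continuous_ofReal.tendsto _).comp (hφ j)
  refine ⟨Q, ⟨?_, fun j => ?_, fun j => ?_⟩, fun j => ?_, hQ⟩
  · refine tendsto_nhds_unique (tendsto_finsetSum Finset.univ fun j _ => hQ j) ?_
    simp only [(h.resolution _).sum_eq_one]
    exact tendsto_const_nhds
  · refine tendsto_nhds_unique (hb.mul (hQ j)) ?_
    simp only [(h.resolution _).mul_left]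
    exact (hφ' j).smul (hQ j)
  · refine tendsto_nhds_unique ((hQ j).mul hb) ?_
    simp only [(h.resolution _).mul_right]
    exact (hφ' j).smul (hQ j)
  · exact le_of_tendsto' (hQ j).norm fun t => h.norm_proj_le j t

/-- The free evolution pulled back along the perturbed one converges: each of its components differs
from a mode by the convergent phase `e^{i r ∫₀ᵗ (φⱼ - φlⱼ)}` and by the vanishing error
`(Qⱼ - Pⱼ) Y`. -/
theorem exists_tendsto_spectralExp_mul_atTop (h : IsSpectralPath b φ P g K d M)
    {φl : ι → ℝ} {Q : ι → 𝔸} (hQ : ∀ j, Tendsto (P j) atTop (𝓝 (Q j)))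
    (hint : ∀ j, ∃ θ, Tendsto (fun t => ∫ s in (0 : ℝ)..t, (φ j s - φl j)) atTop (𝓝 θ))
    {r : ℝ} {Y : ℝ → 𝔸}
    (hY : ∀ t, HasDerivAt Y ((Complex.I * (r : ℂ)) • (b t * Y t)) t) :
    ∃ Ω, Tendsto (fun t => spectralExp φl Q r (-t) * Y t) atTop (𝓝 Ω) := by
  have hYc : Continuous Y := continuous_iff_continuousAt.2 fun t => (hY t).continuousAt
  set B : ℝ := energyConst ι K d M * ‖Y 0‖ with hB
  have hYB : ∀ t, ‖Y t‖ ≤ B := fun t => h.norm_le hY 0 t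
  have hB0 : 0 ≤ B := (norm_nonneg _).trans (hYB 0)
  have hc : 0 ≤ projConst ι K d := projConst_nonneg h.pos
  -- As `Y` is bounded, the modes have finite variation.
  have hmode : ∀ j, ∃ l, Tendsto (mode φ P r Y j) atTop (𝓝 l) := by
    intro j
    refine exists_tendsto_atTop_of_norm_sub_le (C := projConst ι K d * B) (by positivity)
      h.monotone_var h.var_le fun s t hst => ?_
    have := norm_sub_le_of_eventually_le (h.continuous_mode r hYc j)
      (G := fun t => projConst ι K d * B * g t) (continuous_const.mul h.continuous_var) (by
        intro x ε hε
        filter_upwards [h.eventually_norm_mode_sub_le hY j x hε, self_mem_nhdsWithin]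
          with y hy hxy
        have hg : 0 ≤ g y - g x := sub_nonneg.2 (h.monotone_var (le_of_lt hxy))
        have : projConst ι K d * (g y - g x) * ‖Y y‖ ≤ projConst ι K d * (g y - g x) * B :=
          mul_le_mul_of_nonneg_left (hYB y) (by positivity)
        nlinarith) hst
    linarith
  have hterm : ∀ j, ∃ l, Tendsto (fun t =>
      Complex.exp (Complex.I * ((r * -t * φl j : ℝ) : ℂ)) • (Q j * Y t)) atTop (𝓝 l) := by
    intro j
    obtain ⟨l, hl⟩ := hmode j
    obtain ⟨θ, hθ⟩ := hint j
    have h1 : Tendsto (fun t => Complex.exp (Complex.I *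
        ((r * ∫ s in (0 : ℝ)..t, (φ j s - φl j) : ℝ) : ℂ)) • mode φ P r Y j t) atTop
        (𝓝 (Complex.exp (Complex.I * ((r * θ : ℝ) : ℂ)) • l)) := by
      refine Tendsto.smul ?_ hl
      have : Continuous fun x : ℝ => Complex.exp (Complex.I * ((r * x : ℝ) : ℂ)) := by fun_prop
      exact (this.tendsto θ).comp hθ
    have h2 : Tendsto (fun t => Complex.exp (Complex.I * ((r * -t * φl j : ℝ) : ℂ)) •
        ((Q j - P j t) * Y t)) atTop (𝓝 0) := by
      have h3 : Tendsto (fun t => ‖Q j - P j t‖ * B) atTop (𝓝 0) := by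
        simpa using ((tendsto_const_nhds (x := Q j)).sub (hQ j)).norm.mul_const B
      refine squeeze_zero_norm (fun t => ?_) h3
      rw [norm_smul, Complex.norm_exp_I_mul_ofReal, one_mul]
      exact (norm_mul_le _ _).trans (mul_le_mul_of_nonneg_left (hYB t) (norm_nonneg _))
    refine ⟨_, (h2.add h1).congr fun t => ?_⟩
    rw [mode, smul_smul, ← Complex.exp_add]
    have e : Complex.I * ((r * ∫ s in (0 : ℝ)..t, (φ j s - φl j) : ℝ) : ℂ)
        + -(Complex.I * ((r * ∫ s in (0 : ℝ)..t, φ j s : ℝ) : ℂ))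
        = Complex.I * ((r * -t * φl j : ℝ) : ℂ) := by
      rw [intervalIntegral.integral_sub ((h.continuous_root j).intervalIntegrable _ _)
        intervalIntegrable_const, intervalIntegral.integral_const]
      push_cast [smul_eq_mul]
      ring
    rw [e, ← smul_add, ← add_mul, sub_add_cancel]
  choose l hl using hterm
  refine ⟨∑ j, l j, (tendsto_finsetSum Finset.univ fun j _ => hl j).congr fun t => ?_⟩
  simp only [spectralExp, Finset.sum_mul, smul_mul_assoc]

theorem tendsto_integral_reverse {f : ℝ → ℝ} {c θ : ℝ}
    (h : Tendsto (fun t => ∫ s in (0 : ℝ)..t, (f s - c)) atBot (𝓝 θ)) :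
    Tendsto (fun t => ∫ s in (0 : ℝ)..t, (f (-s) - c)) atTop (𝓝 (-θ)) := by
  refine (h.comp tendsto_neg_atTop_atBot).neg.congr fun t => ?_
  have := intervalIntegral.integral_comp_neg (a := 0) (b := t) (fun s => f s - c)
  rw [this, neg_zero, intervalIntegral.integral_symm 0 (-t)]
  rfl

theorem exists_wave_limit (h : IsSpectralPath b φ P g K d M) (hP : ∀ j t, P j t ≠ 0)
    (e : TimeEnd) {bl : 𝔸} {φl : ι → ℝ} (hb : Tendsto b e.limit (𝓝 bl))
    (hint : ∀ j, ∃ θ, Tendsto (fun t => ∫ s in (0 : ℝ)..t, (φ j s - φl j)) e.limit (𝓝 θ))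
    {r : ℝ} {Y : ℝ → 𝔸}
    (hY : ∀ t, HasDerivAt Y ((Complex.I * (r : ℂ)) • (b t * Y t)) t) :
    ∃ Q : ι → 𝔸, IsSpectralResolution bl φl Q ∧ (∀ j, ‖Q j‖ ≤ K) ∧
      ∃ Ω, Tendsto (fun t => spectralExp φl Q r (-t) * Y t) e.limit (𝓝 Ω) := by
  cases e with
  | plus =>
    obtain ⟨Q, hQ, hK, hPQ⟩ := h.exists_tendsto_proj_atTop hP hb hint
    exact ⟨Q, hQ, hK, h.exists_tendsto_spectralExp_mul_atTop hPQ hint hY⟩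
  | minus =>
    have hint' : ∀ j, ∃ θ, Tendsto (fun t => ∫ s in (0 : ℝ)..t, (φ j (-s) - φl j)) atTop (𝓝 θ) :=
      fun j => ⟨_, tendsto_integral_reverse (hint j).choose_spec⟩
    obtain ⟨Q, hQ, hK, hPQ⟩ := h.reverse.exists_tendsto_proj_atTop (fun j t => hP j (-t))
      (hb.comp tendsto_neg_atTop_atBot) hint'
    obtain ⟨Ω, hΩ⟩ := h.reverse.exists_tendsto_spectralExp_mul_atTop hPQ hint'
      (hasDerivAt_reverse hY)
    refine ⟨Q, hQ, hK, Ω, (hΩ.comp tendsto_neg_atBot_atTop).congr fun t => ?_⟩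
    simp only [Function.comp_apply, spectralExp_neg_neg, neg_neg]

/-- A bound for the propagator, the free propagator, the wave limit and the inverses occurring in
`IsWavePair`. It depends only on the separation `d`, the bound `K` for the projections and the
total variation `M`. -/
noncomputable def waveConst (𝔸 ι : Type*) [NormedRing 𝔸] [Fintype ι] (K d M : ℝ) : ℝ :=
  (energyConst ι K d M + Fintype.card ι * K + energyConst ι K d M * (Fintype.card ι * K)) *
    (1 + ‖(1 : 𝔸)‖)

/-- The propagators `Y` of the path and `Z` of its limit form a wave pair. The inverses are bounded
because `t ↦ Y(t) c` is a solution for each `c`, so that `c = Y(0) c` is controlled by `Y(t) c`. -/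
theorem wave_estimates [FiniteDimensional ℂ 𝔸] (h : IsSpectralPath b φ P g K d M)
    (hK : 0 ≤ K)    (hP : ∀ j t, P j t ≠ 0)
    (e : TimeEnd) {bl : 𝔸} {φl : ι → ℝ} (hφl : Function.Injective φl)
    (hb : Tendsto b e.limit (𝓝 bl))
    (hint : ∀ j, ∃ θ, Tendsto (fun t => ∫ s in (0 : ℝ)..t, (φ j s - φl j)) e.limit (𝓝 θ))
    {r : ℝ} {Y Z : ℝ → 𝔸}
    (hY : ∀ t, HasDerivAt Y ((Complex.I * (r : ℂ)) • (b t * Y t)) t) (hY0 : Y 0 = 1)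
    (hZ : ∀ t, HasDerivAt Z ((Complex.I * (r : ℂ)) • (bl * Z t)) t) (hZ0 : Z 0 = 1) :
    IsWavePair e (waveConst 𝔸 ι K d M) Y Z := by
  set C : ℝ := energyConst ι K d M with hC
  set D : ℝ := Fintype.card ι * K with hD
  have hD0 : 0 ≤ D := by positivity
  have hC0 : 0 ≤ C := by rw [hC, energyConst]; positivity
  have hu : 0 ≤ ‖(1 : 𝔸)‖ := norm_nonneg _
  have hCD : 0 ≤ C * D := mul_nonneg hC0 hD0
  have hW : waveConst 𝔸 ι K d M = (C + D + C * D) * (1 + ‖(1 : 𝔸)‖) := rfl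
  have hYc : ∀ (c : 𝔸) (s t : ℝ), ‖Y t * c‖ ≤ C * ‖Y s * c‖ := by
    intro c s t
    refine h.norm_le (Y := fun t => Y t * c) (r := r) (fun t => ?_) s t
    have := (hY t).mul_const c
    rwa [smul_mul_assoc, mul_assoc] at this
  have hYinv : ∀ (c : 𝔸) (t : ℝ), ‖c‖ ≤ C * ‖Y t * c‖ := fun c t => by
    simpa [hY0] using hYc c t 0
  obtain ⟨Q, hQ, hQK, Ω, hΩ⟩ := h.exists_wave_limit hP e hb hint hY
  have hZE : ∀ t, Z t = spectralExp φl Q r t := hQ.eq_spectralExp hφl hZ hZ0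
  have hZD : ∀ t, ‖Z t‖ ≤ D := fun t => by rw [hZE]; exact norm_spectralExp_le hQK r t
  have hZZ : ∀ t, Z t * Z (-t) = 1 := fun t => by
    rw [hZE, hZE]; exact hQ.spectralExp_mul_spectralExp_neg hφl r t
  have hΩ' : Tendsto (fun t => Z (-t) * Y t) e.limit (𝓝 Ω) := by simpa only [hZE] using hΩ
  have hΩc : ∀ c, ‖c‖ ≤ C * D * ‖Ω * c‖ := by
    intro c
    have : e.limit.NeBot := by cases e <;> simp only [TimeEnd.limit] <;> infer_instance
    refine ge_of_tendsto' (((hΩ'.mul_const c).norm).const_mul (C * D)) fun t => ?_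
    have h1 : Y t * c = Z t * (Z (-t) * Y t * c) := by
      rw [← mul_assoc, ← mul_assoc, hZZ, one_mul]
    calc ‖c‖ ≤ C * ‖Y t * c‖ := hYinv c t
      _ ≤ C * (D * ‖Z (-t) * Y t * c‖) := by
          rw [h1]
          refine mul_le_mul_of_nonneg_left ((norm_mul_le _ _).trans ?_) hC0
          exact mul_le_mul_of_nonneg_right (hZD t) (norm_nonneg _)
      _ = _ := by ring
  have hu' := fun t => isUnit_of_norm_le (a := Y t) (C := C) (fun c => hYinv c t)
  have hle : C * ‖(1 : 𝔸)‖ ≤ waveConst 𝔸 ι K d M := by rw [hW]; nlinarith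
  refine ⟨fun t => ?_, fun t => (hu' t).1, fun t => (hu' t).2.trans hle,
    fun t => (hZD t).trans ?_, hZZ, Ω, hΩ', ?_⟩
  · have h3 := hYc 1 0 t
    rw [hY0, mul_one, mul_one] at h3
    exact h3.trans hle
  · rw [hW]; nlinarith
  · obtain ⟨h1, h2⟩ := isUnit_of_norm_le (a := Ω) (C := C * D) hΩc
    refine ⟨h1, h2.trans ?_⟩
    rw [hW]; nlinarith

end IsSpectralPath

end Asymptotics

/-! ### The propagator and its measurability -/

section Dyson

variable {𝔸 X : Type*} [NormedRing 𝔸] [NormedAlgebra ℂ 𝔸]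

/-- The iterated integrals `Dₖ(t)` of `G`: `D₀ = 1` and `Dₖ₊₁(t) = ∫₀ᵗ G Dₖ`. -/
noncomputable def dysonTerm (G : ℝ → X → 𝔸) : ℕ → ℝ → X → 𝔸
  | 0, _, _ => 1
  | k + 1, t, x => ∫ s in (0 : ℝ)..t, G s x * dysonTerm G k s x

/-- The propagator of `Y' = G Y`, as the sum of its Dyson series. -/
noncomputable def dyson (G : ℝ → X → 𝔸) (t : ℝ) (x : X) : 𝔸 := ∑' k, dysonTerm G k t x

variable {G : ℝ → X → 𝔸} {x : X}

theorem norm_dysonTerm_le {L : ℝ} (hL : ∀ t, ‖G t x‖ ≤ L) (k : ℕ) (t : ℝ) :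
    ‖dysonTerm G k t x‖ ≤ ‖(1 : 𝔸)‖ * ((L * |t|) ^ k / k.factorial) := by
  have hL0 : 0 ≤ L := (norm_nonneg _).trans (hL 0)
  induction k generalizing t with
  | zero => simp [dysonTerm]
  | succ k ih =>
    have h1 : ‖dysonTerm G (k + 1) t x‖ ≤
        |∫ s in (0 : ℝ)..t, ‖(1 : 𝔸)‖ * L ^ (k + 1) / k.factorial * |s - 0| ^ k| := by
      refine intervalIntegral.norm_integral_le_abs_of_norm_le (.of_forall fun s => ?_)
        (Continuous.intervalIntegrable (by fun_prop) _ _)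
      calc ‖G s x * dysonTerm G k s x‖ ≤ L * (‖(1 : 𝔸)‖ * ((L * |s|) ^ k / k.factorial)) := by
            refine (norm_mul_le _ _).trans ?_
            gcongr
            · exact hL s
            · exact ih s
        _ = _ := by rw [sub_zero, mul_pow, pow_succ]; ring
    refine h1.trans_eq ?_
    rw [intervalIntegral.abs_intervalIntegral_eq, integral_const_mul, integral_pow_abs_sub_uIoc,
      sub_zero, abs_of_nonneg (by positivity), Nat.factorial_succ, mul_pow]
    push_cast
    field_simp

theorem summable_dysonTerm [CompleteSpace 𝔸] {L : ℝ} (hL : ∀ t, ‖G t x‖ ≤ L) (t : ℝ) :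
    Summable fun k => dysonTerm G k t x :=
  .of_norm_bounded ((Real.summable_pow_div_factorial (L * |t|)).mul_left _)
    fun k => norm_dysonTerm_le hL k t

theorem continuous_dysonTerm [CompleteSpace 𝔸] (hG : Continuous fun t => G t x) (k : ℕ) :
    Continuous fun t => dysonTerm G k t x := by
  induction k with
  | zero => exact continuous_const
  | succ k ih =>
    exact intervalIntegral.continuous_primitive
      (fun a b => (hG.mul ih).intervalIntegrable a b) 0

theorem hasDerivAt_dysonTerm_succ [CompleteSpace 𝔸] (hG : Continuous fun t => G t x) (k : ℕ)
    (t : ℝ) :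
    HasDerivAt (fun t => dysonTerm G (k + 1) t x) (G t x * dysonTerm G k t x) t :=
  ((hG.mul (continuous_dysonTerm hG k)).integral_hasStrictDerivAt 0 t).hasDerivAt

theorem dyson_zero : dyson G 0 x = 1 := by
  rw [dyson, tsum_eq_single 0]
  · rfl
  · rintro (_ | k) hk
    · exact absurd rfl hk
    · simp [dysonTerm]

theorem hasDerivAt_dyson [CompleteSpace 𝔸] (hG : Continuous fun t => G t x) {L : ℝ}
    (hL : ∀ t, ‖G t x‖ ≤ L) (t : ℝ) :
    HasDerivAt (fun t => dyson G t x) (G t x * dyson G t x) t := by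
  have hL0 : 0 ≤ L := (norm_nonneg _).trans (hL 0)
  have e : ∀ t, dyson G t x = 1 + ∑' k, dysonTerm G (k + 1) t x := fun t => by
    rw [dyson, (summable_dysonTerm hL t).tsum_eq_zero_add]
    rfl
  have hd : HasDerivAt (fun t => ∑' k, dysonTerm G (k + 1) t x)
      (∑' k, G t x * dysonTerm G k t x) t := by
    set T : ℝ := |t| + 1 with hT
    have hu : Summable fun k : ℕ => L * (‖(1 : 𝔸)‖ * ((L * T) ^ k / k.factorial)) :=
      ((Real.summable_pow_div_factorial (L * T)).mul_left _).mul_left _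
    have hg : ∀ (k : ℕ) (y : ℝ), y ∈ Metric.ball (0 : ℝ) T →
        HasDerivAt (fun t => dysonTerm G (k + 1) t x) (G y x * dysonTerm G k y x) y :=
      fun k y _ => hasDerivAt_dysonTerm_succ hG k y
    have hg' : ∀ (k : ℕ) (y : ℝ), y ∈ Metric.ball (0 : ℝ) T →
        ‖G y x * dysonTerm G k y x‖ ≤ L * (‖(1 : 𝔸)‖ * ((L * T) ^ k / k.factorial)) := by
      intro k y hy
      have hy' : |y| ≤ T := by simpa using (mem_ball_zero_iff.1 hy).le
      refine (norm_mul_le _ _).trans ?_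
      gcongr
      · exact hL y
      · refine (norm_dysonTerm_le hL k y).trans ?_
        gcongr
    have ht : t ∈ Metric.ball (0 : ℝ) T := by simp [hT]
    have hs : Summable fun k => dysonTerm G (k + 1) t x :=
      (summable_nat_add_iff 1).2 (summable_dysonTerm hL t)
    exact hasDerivAt_tsum_of_isPreconnected hu Metric.isOpen_ball
      (convex_ball _ _).isPreconnected hg hg' ht hs ht
  rw [funext e]
  rw [(summable_dysonTerm hL t).tsum_mul_left] at hd
  exact hd.const_add 1

/-- Measurability in the parameter passes through the iterated integrals because the integrands,
continuous in time and measurable in the parameter, are jointly measurable. -/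
theorem stronglyMeasurable_dysonTerm [CompleteSpace 𝔸] [MeasurableSpace X]
    (hG : ∀ x, Continuous fun t => G t x) (hGm : ∀ t, StronglyMeasurable (G t)) (k : ℕ) (t : ℝ) :
    StronglyMeasurable (dysonTerm G k t) := by
  induction k generalizing t with
  | zero => exact stronglyMeasurable_const
  | succ k ih =>
    have h1 : StronglyMeasurable (Function.uncurry fun s x => G s x * dysonTerm G k s x) :=
      stronglyMeasurable_uncurry_of_continuous_of_stronglyMeasurable
        (fun x => (hG x).mul (continuous_dysonTerm (hG x) k)) (fun s => (hGm s).mul (ih s))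
    have h2 : ∀ S : Set ℝ, StronglyMeasurable fun x =>
        ∫ s in S, G s x * dysonTerm G k s x := fun S =>
      h1.integral_prod_left (μ := volume.restrict S)
    exact (h2 (Ioc 0 t)).sub (h2 (Ioc t 0))

theorem stronglyMeasurable_dyson [CompleteSpace 𝔸] [MeasurableSpace X]
    (hG : ∀ x, Continuous fun t => G t x) (hGm : ∀ t, StronglyMeasurable (G t))
    (hL : ∀ x, ∃ L, ∀ t, ‖G t x‖ ≤ L) (t : ℝ) :
    StronglyMeasurable (dyson G t) := by
  refine stronglyMeasurable_of_tendsto atTop (f := fun N x => ∑ k ∈ Finset.range N,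
    dysonTerm G k t x) (fun N => Finset.stronglyMeasurable_fun_sum _ fun k _ =>
      stronglyMeasurable_dysonTerm hG hGm k t) ?_
  rw [tendsto_pi_nhds]
  intro x
  obtain ⟨L, hL⟩ := hL x
  exact (summable_dysonTerm hL t).hasSum.tendsto_sum_nat

end Dyson

section RingInverse

theorem stronglyMeasurable_ringInverse {𝔸 X : Type*} [NormedRing 𝔸] [CompleteSpace 𝔸]
    [SecondCountableTopology 𝔸] [MeasurableSpace X] {f : X → 𝔸} (hf : StronglyMeasurable f) :
    StronglyMeasurable fun x => Ring.inverse (f x) := by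
  classical
  borelize 𝔸
  have hm : Measurable (Ring.inverse : 𝔸 → 𝔸) := by
    have hs : MeasurableSet {a : 𝔸 | IsUnit a} := (Units.isOpen (R := 𝔸)).measurableSet
    have h1 : ContinuousOn (Ring.inverse : 𝔸 → 𝔸) {a : 𝔸 | IsUnit a} := by
      rintro _ ⟨u, rfl⟩
      exact (NormedRing.inverse_continuousAt u).continuousWithinAt
    have h2 := h1.measurable_piecewise (g := fun _ => (0 : 𝔸)) continuousOn_const hs
    convert! h2 using 1
    ext a
    by_cases ha : IsUnit a
    · simp [Set.piecewise, ha]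
    · simp [Set.piecewise, ha, Ring.inverse_non_unit]
  exact (hm.comp hf.measurable).stronglyMeasurable

end RingInverse

/-! ### Spectral projections from the characteristic polynomial -/

section Lagrange

open Polynomial

variable {𝔸 ι : Type*} [NormedRing 𝔸] [NormedAlgebra ℂ 𝔸] [Fintype ι] [DecidableEq ι]

/-- The spectral projection of `b` onto the simple eigenvalue `φⱼ`, as the value at `b` of the
Lagrange basis polynomial `∏_{k ≠ j} (X - φₖ) / (φⱼ - φₖ)`. -/
noncomputable def spectralProj (b : 𝔸) (φ : ι → ℝ) (j : ι) : 𝔸 :=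
  aeval b (Lagrange.basis Finset.univ (fun k => (φ k : ℂ)) j)

theorem X_sub_C_mul_lagrange_basis {F : Type*} [Field F] (v : ι → F) (j : ι) :
    (X - C (v j)) * Lagrange.basis Finset.univ v j =
      (∏ k ∈ Finset.univ.erase j, C (v j - v k)⁻¹) * ∏ k, (X - C (v k)) := by
  simp only [Lagrange.basis, Lagrange.basisDivisor, Finset.prod_mul_distrib]
  rw [← Finset.mul_prod_erase Finset.univ (fun k => X - C (v k)) (Finset.mem_univ j)]
  ring

/-- If the product of the `X - φₖ` annihilates `b` then the Lagrange projections resolve `b`. The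
hypothesis on an empty index set covers matrices of size `0`, for which the empty sum of projections
is `1` because the algebra is trivial. -/
theorem isSpectralResolution_spectralProj {b : 𝔸} {φ : ι → ℝ} (hφ : Function.Injective φ)
    (hb : aeval b (∏ k, (X - C ((φ k : ℝ) : ℂ))) = 0) (hsub : IsEmpty ι → Subsingleton 𝔸) :
    IsSpectralResolution b φ (spectralProj b φ) := by
  have hφ' : Function.Injective fun k => (φ k : ℂ) := Complex.ofReal_injective.comp hφ
  have hz : ∀ j, (b - algebraMap ℂ 𝔸 (φ j)) * spectralProj b φ j = 0 := by
    intro j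
    have := congrArg (aeval b) (X_sub_C_mul_lagrange_basis (fun k => (φ k : ℂ)) j)
    rw [map_mul, map_mul, hb, mul_zero, map_sub, aeval_X, aeval_C] at this
    exact this
  have hl : ∀ j, b * spectralProj b φ j = (φ j : ℂ) • spectralProj b φ j := by
    intro j
    have := hz j
    rwa [sub_mul, sub_eq_zero, ← Algebra.smul_def] at this
  refine ⟨?_, hl, fun j => ?_⟩
  · rcases isEmpty_or_nonempty ι with h | h
    · have := hsub h
      exact Subsingleton.elim _ _
    · simp only [spectralProj]
      rw [← map_sum, Lagrange.sum_basis hφ'.injOn Finset.univ_nonempty, map_one]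
  · rw [← hl j]
    have h1 : aeval b (X : ℂ[X]) * spectralProj b φ j = spectralProj b φ j * aeval b (X : ℂ[X]) := by
      rw [spectralProj, ← map_mul, ← map_mul, mul_comm]
    rw [aeval_X] at h1
    exact h1.symm

/-- By the spectral mapping theorem `1` is in the spectrum of the projection onto an eigenvalue. -/
theorem spectralProj_ne_zero {b : 𝔸} {φ : ι → ℝ} (hφ : Function.Injective φ) {j : ι}
    (hj : (φ j : ℂ) ∈ spectrum ℂ b) : spectralProj b φ j ≠ 0 := by
  have hφ' : Function.Injective fun k => (φ k : ℂ) := Complex.ofReal_injective.comp hφ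
  intro h0
  have h1 := spectrum.subset_polynomial_aeval b
    (Lagrange.basis Finset.univ (fun k => (φ k : ℂ)) j) ⟨_, hj, rfl⟩
  have h2 := Lagrange.eval_basis_self hφ'.injOn (Finset.mem_univ j)
  simp only [h2] at h1
  change aeval b _ = 0 at h0
  rw [h0, spectrum.mem_iff] at h1
  simp at h1

theorem norm_spectralProj_le {b : 𝔸} {φ : ι → ℝ} {R d : ℝ} (hd : 0 < d)
    (hsep : ∀ j k, j ≠ k → d ≤ |φ j - φ k|) (hb : ‖b‖ ≤ R) (h1 : ‖(1 : 𝔸)‖ ≤ 1)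
    (hφ : ∀ j, |φ j| ≤ R) (j : ι) :
    ‖spectralProj b φ j‖ ≤ (2 * R / d) ^ (Fintype.card ι - 1) := by
  have hR : 0 ≤ R := (norm_nonneg _).trans hb
  have key : ∀ s : Finset ι, s ⊆ Finset.univ.erase j →
      ‖aeval b (∏ k ∈ s, Lagrange.basisDivisor (φ j : ℂ) (φ k : ℂ))‖ ≤ (2 * R / d) ^ s.card := by
    intro s
    induction s using Finset.induction_on with
    | empty => intro _; simpa using h1
    | insert a s ha ih =>
      intro hs
      have haj : j ≠ a := (Finset.ne_of_mem_erase (hs (Finset.mem_insert_self a s))).symm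
      have h2 : ‖aeval b (Lagrange.basisDivisor (φ j : ℂ) (φ a : ℂ))‖ ≤ 2 * R / d := by
        rw [Lagrange.basisDivisor, map_mul, aeval_C, map_sub, aeval_X, aeval_C,
          ← Algebra.smul_def, norm_smul, norm_inv, ← Complex.ofReal_sub, Complex.norm_real,
          Real.norm_eq_abs, inv_mul_eq_div]
        have h3 : ‖b - algebraMap ℂ 𝔸 (φ a : ℂ)‖ ≤ 2 * R := by
          refine (norm_sub_le _ _).trans ?_
          rw [norm_algebraMap, Complex.norm_real, Real.norm_eq_abs]
          have := mul_le_mul (hφ a) h1 (norm_nonneg _) hR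
          linarith
        gcongr
        exact hsep j a haj
      rw [Finset.prod_insert ha, map_mul, Finset.card_insert_of_notMem ha, pow_succ]
      refine (norm_mul_le _ _).trans ?_
      rw [mul_comm (_ ^ _)]
      exact mul_le_mul h2 (ih ((Finset.subset_insert a s).trans hs)) (norm_nonneg _)
        (by positivity)
  have := key _ le_rfl
  rwa [Finset.card_erase_of_mem (Finset.mem_univ j), Finset.card_univ] at this

end Lagrange

/-! ### Variation of locally Lipschitz functions -/

section Variation

theorem norm_sub_le_integral_norm_deriv {a : ℝ → ℂ} (ha : LocallyLipschitz a)
    (hi : Integrable (deriv a)) {s t : ℝ} (hst : s ≤ t) :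
    ‖a t - a s‖ ≤ ∫ x in s..t, ‖deriv a x‖ := by
  obtain ⟨K, hK⟩ := ha.locallyLipschitzOn (s := uIcc s t) |>.exists_lipschitzOnWith_of_compact
    isCompact_uIcc
  -- Rotating `a t - a s` onto the positive real axis reduces to a real valued function.
  obtain ⟨z, hz, hza⟩ : ∃ z : ℂ, ‖z‖ = 1 ∧ (z * (a t - a s)).re = ‖a t - a s‖ := by
    by_cases h0 : a t - a s = 0
    · exact ⟨1, by simp, by simp [h0]⟩
    · have hn : (‖a t - a s‖ : ℂ) ≠ 0 := by simpa using h0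
      refine ⟨(starRingEnd ℂ) (a t - a s) / ‖a t - a s‖, ?_, ?_⟩
      · rw [norm_div, RCLike.norm_conj, Complex.norm_real, norm_norm, div_self]
        simpa using h0
      · rw [div_mul_eq_mul_div, Complex.conj_mul', pow_two, mul_div_assoc, div_self hn, mul_one,
          Complex.ofReal_re]
  let ℓ : ℂ →L[ℝ] ℝ := Complex.reCLM.comp ((ContinuousLinearMap.mul ℝ ℂ) z)
  have hℓ : ∀ w, ℓ w = (z * w).re := fun w => rfl
  have hac : AbsolutelyContinuousOnInterval (fun x => ℓ (a x)) s t :=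
    (ℓ.lipschitz.comp_lipschitzOnWith hK).absolutelyContinuousOnInterval
  have hd : ∀ᵐ x, x ∈ Ioo s t → DifferentiableAt ℝ a x := by
    filter_upwards [hK.ae_differentiableWithinAt_of_mem_real] with x hx hxs
    rw [uIcc_of_le hst] at hx
    exact (hx (Ioo_subset_Icc_self hxs)).differentiableAt (Icc_mem_nhds hxs.1 hxs.2)
  have hle : ∀ᵐ x, x ∈ Ioo s t → deriv (fun x => ℓ (a x)) x ≤ ‖deriv a x‖ := by
    filter_upwards [hd] with x hx hxs
    have h1 : HasDerivAt (fun x => ℓ (a x)) (ℓ (deriv a x)) x :=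
      ℓ.hasFDerivAt.comp_hasDerivAt x (hx hxs).hasDerivAt
    rw [h1.deriv, hℓ]
    refine (Complex.re_le_norm _).trans ?_
    rw [norm_mul, hz, one_mul]
  calc ‖a t - a s‖ = ℓ (a t) - ℓ (a s) := by rw [← map_sub, hℓ, hza]
    _ = ∫ x in s..t, deriv (fun x => ℓ (a x)) x := hac.integral_deriv_eq_sub.symm
    _ ≤ ∫ x in s..t, ‖deriv a x‖ := by
        refine intervalIntegral.integral_mono_ae_restrict hst hac.intervalIntegrable_deriv
          hi.norm.intervalIntegrable ?_
        rw [Measure.restrict_congr_set (Ioo_ae_eq_Icc (a := s) (b := t)).symm]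
        exact (ae_restrict_iff' measurableSet_Ioo).2 hle

end Variation

/-! ### Matrix symbols as endomorphisms -/

section Symbol

/-- The endomorphisms of `ℂᵐ`. -/
abbrev EndC (m : ℕ) : Type := EuclideanSpace ℂ (Fin m) →L[ℂ] EuclideanSpace ℂ (Fin m)

/-- The endomorphism of `ℂᵐ` defined by a matrix. -/
noncomputable def matEnd {m : ℕ} (B : Matrix (Fin m) (Fin m) ℂ) : EndC m :=
  Matrix.toEuclideanCLM (n := Fin m) (𝕜 := ℂ) B

variable {n m : ℕ}

theorem norm_one_endC_le : ‖(1 : EndC m)‖ ≤ 1 := ContinuousLinearMap.norm_id_le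

theorem matEnd_smul (c : ℂ) (B : Matrix (Fin m) (Fin m) ℂ) : matEnd (c • B) = c • matEnd B :=
  map_smul (Matrix.toEuclideanCLM (n := Fin m) (𝕜 := ℂ)) c B

theorem matEnd_sub (B B' : Matrix (Fin m) (Fin m) ℂ) : matEnd (B - B') = matEnd B - matEnd B' :=
  map_sub (Matrix.toEuclideanCLM (n := Fin m) (𝕜 := ℂ)) B B'

theorem matEnd_eq_sum (B : Matrix (Fin m) (Fin m) ℂ) :
    matEnd B = ∑ i, ∑ j, B i j • matEnd (Matrix.single i j 1) := by
  conv_lhs => rw [Matrix.matrix_eq_sum_single B]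
  rw [matEnd, map_sum]
  refine Finset.sum_congr rfl fun i _ => ?_
  rw [map_sum]
  refine Finset.sum_congr rfl fun j _ => ?_
  rw [← matEnd_smul, Matrix.smul_single, smul_eq_mul, mul_one]
  rfl

/-- A constant comparing the operator norm of a matrix with the sum of its entries. -/
noncomputable def matConst (m : ℕ) : ℝ :=
  ∑ i : Fin m, ∑ j : Fin m, ‖matEnd (Matrix.single i j 1)‖

theorem matConst_nonneg : 0 ≤ matConst m :=
  Finset.sum_nonneg fun _ _ => Finset.sum_nonneg fun _ _ => norm_nonneg _

theorem norm_matEnd_le (B : Matrix (Fin m) (Fin m) ℂ) :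
    ‖matEnd B‖ ≤ matConst m * ∑ i, ∑ j, ‖B i j‖ := by
  rw [matEnd_eq_sum, Finset.mul_sum]
  refine norm_sum_le_of_le _ fun i _ => ?_
  rw [Finset.mul_sum]
  refine norm_sum_le_of_le _ fun j _ => ?_
  rw [norm_smul, mul_comm]
  refine mul_le_mul_of_nonneg_right ?_ (norm_nonneg _)
  have h1 : ‖matEnd (Matrix.single i j (1 : ℂ))‖ ≤
      ∑ j, ‖matEnd (m := m) (Matrix.single i j 1)‖ :=
    Finset.single_le_sum (f := fun j => ‖matEnd (m := m) (Matrix.single i j 1)‖)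
      (fun _ _ => norm_nonneg _) (Finset.mem_univ j)
  exact h1.trans (Finset.single_le_sum
    (f := fun i => ∑ j, ‖matEnd (m := m) (Matrix.single i j 1)‖)
    (fun _ _ => Finset.sum_nonneg fun _ _ => norm_nonneg _) (Finset.mem_univ i))

theorem tendsto_matEnd {α : Type*} {l : Filter α} {B : α → Matrix (Fin m) (Fin m) ℂ}
    {B' : Matrix (Fin m) (Fin m) ℂ} (h : ∀ i j, Tendsto (fun x => B x i j) l (𝓝 (B' i j))) :
    Tendsto (fun x => matEnd (B x)) l (𝓝 (matEnd B')) := by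
  refine Tendsto.congr (fun x => (matEnd_eq_sum (B x)).symm) ?_
  rw [matEnd_eq_sum B']
  exact tendsto_finsetSum _ fun i _ => tendsto_finsetSum _ fun j _ => (h i j).smul_const _

theorem aeval_matEnd_charpoly (B : Matrix (Fin m) (Fin m) ℂ) :
    Polynomial.aeval (matEnd B) B.charpoly = 0 := by
  have := Polynomial.aeval_algHom_apply
    (Matrix.toEuclideanCLM (n := Fin m) (𝕜 := ℂ)) B B.charpoly
  rw [Matrix.aeval_self_charpoly, map_zero] at this
  exact this

theorem spectrum_matEnd (B : Matrix (Fin m) (Fin m) ℂ) :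
    spectrum ℂ (matEnd B) = spectrum ℂ B :=
  AlgEquiv.spectrum_eq (Matrix.toEuclideanCLM (n := Fin m) (𝕜 := ℂ)) B

/-- The generator `i P(2πξ)` of the frequency side equation at the frequency `ξ`; the value at
`ξ = 0`, where symbols carry no information, is set to `0`. -/
noncomputable def symbolGen (B : Space n → Matrix (Fin m) (Fin m) ℂ) (ξ : Space n) : EndC m :=
  open Classical in if ξ = 0 then 0 else Complex.I • matEnd (B ((2 * Real.pi) • ξ))

theorem symbolGen_zero (B : Space n → Matrix (Fin m) (Fin m) ℂ) : symbolGen B 0 = 0 := if_pos rfl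

theorem symbolGen_of_ne (B : Space n → Matrix (Fin m) (Fin m) ℂ) {ξ : Space n} (hξ : ξ ≠ 0) :
    symbolGen B ξ = Complex.I • matEnd (B ((2 * Real.pi) • ξ)) := if_neg hξ

/-- For a homogeneous symbol the generator at `ξ` is `i 2π|ξ|` times the value of the symbol at
`ξ / |ξ|`. -/
theorem symbolGen_eq {B : Space n → Matrix (Fin m) (Fin m) ℂ}
    (hB : ∀ c : ℝ, 0 < c → ∀ ξ : Space n, ξ ≠ 0 → B (c • ξ) = (c : ℂ) • B ξ)
    {ξ : Space n} (hξ : ξ ≠ 0) :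
    symbolGen B ξ = (Complex.I * ((2 * Real.pi * ‖ξ‖ : ℝ) : ℂ)) • matEnd (B (‖ξ‖⁻¹ • ξ)) := by
  have hn : 0 < ‖ξ‖ := norm_pos_iff.2 hξ
  have h1 : (2 * Real.pi) • ξ = (2 * Real.pi * ‖ξ‖) • (‖ξ‖⁻¹ • ξ) := by
    rw [smul_smul]; congr 1; field_simp
  rw [symbolGen_of_ne B hξ, h1, hB _ (by positivity) _ (by simp [hξ]), matEnd_smul, smul_smul]

theorem norm_unit {ξ : Space n} (hξ : ξ ≠ 0) : ‖(‖ξ‖⁻¹ • ξ)‖ = 1 := by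
  rw [norm_smul, norm_inv, norm_norm, inv_mul_cancel₀ (norm_ne_zero_iff.2 hξ)]

theorem stronglyMeasurable_symbolGen {B : Space n → Matrix (Fin m) (Fin m) ℂ}
    (hB : ∀ i j, ContinuousOn (fun ξ => B ξ i j) {0}ᶜ) : StronglyMeasurable (symbolGen B) := by
  classical
  borelize (EndC m)
  have h1 : ContinuousOn (fun ξ : Space n => Complex.I • matEnd (B ((2 * Real.pi) • ξ))) {0}ᶜ := by
    suffices h : ContinuousOn (fun ξ : Space n => matEnd (B ((2 * Real.pi) • ξ))) {0}ᶜ from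
      h.const_smul Complex.I
    rw [funext fun ξ : Space n => matEnd_eq_sum (B ((2 * Real.pi) • ξ))]
    refine continuousOn_finsetSum _ fun i _ => continuousOn_finsetSum _ fun j _ => ?_
    suffices h : ContinuousOn (fun ξ : Space n => B ((2 * Real.pi) • ξ) i j) {0}ᶜ from
      h.smul continuousOn_const
    refine (hB i j).comp (f := fun ξ : Space n => (2 * Real.pi) • ξ)
      (continuous_const_smul _).continuousOn fun ξ hξ => ?_
    simpa [Real.pi_ne_zero] using hξ
  have h2 := h1.measurable_piecewise (g := fun _ => (0 : EndC m)) continuousOn_const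
    (measurableSet_singleton 0).compl
  have h3 : symbolGen B = ({0}ᶜ : Set (Space n)).piecewise
      (fun ξ : Space n => Complex.I • matEnd (B ((2 * Real.pi) • ξ))) fun _ => 0 := by
    ext1 ξ
    by_cases hξ : ξ = 0 <;> simp [symbolGen, hξ, Set.piecewise]
  rw [h3]
  exact h2.stronglyMeasurable

end Symbol

/-! ### Symbols on the unit sphere -/

section SymbolPath

variable {n m : ℕ} {A : ℝ → Space n → Matrix (Fin m) (Fin m) ℂ} {φ : Fin m → ℝ → Space n → ℝ}

instance timeEnd_limit_neBot (e : TimeEnd) : e.limit.NeBot := by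
  cases e <;> simp only [TimeEnd.limit] <;> infer_instance

instance timeEnd_limit_isCountablyGenerated (e : TimeEnd) : e.limit.IsCountablyGenerated := by
  cases e <;> simp only [TimeEnd.limit] <;> infer_instance

/-- The total variation on `[0, t]` of the entries of the symbol at the frequency `ω`, normalised so
as to control the operator norm. -/
noncomputable def symbolVar (A : ℝ → Space n → Matrix (Fin m) (Fin m) ℂ) (ω : Space n) (t : ℝ) :
    ℝ :=
  matConst m * ∑ i, ∑ j, ∫ x in (0 : ℝ)..t, ‖deriv (fun s => A s ω i j) x‖

namespace IsAdmissibleSymbol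

theorem symbolVar_sub (hA : IsAdmissibleSymbol A) {ω : Space n} (hω : ω ≠ 0) (s t : ℝ) :
    symbolVar A ω t - symbolVar A ω s =
      matConst m * ∑ i, ∑ j, ∫ x in s..t, ‖deriv (fun s => A s ω i j) x‖ := by
  simp only [symbolVar, ← mul_sub, ← Finset.sum_sub_distrib]
  refine congrArg _ (Finset.sum_congr rfl fun i _ => Finset.sum_congr rfl fun j _ => ?_)
  have hi := (hA.integrable_deriv ω hω i j).norm
  exact intervalIntegral.integral_interval_sub_left hi.intervalIntegrable hi.intervalIntegrable

theorem norm_matEnd_sub_le (hA : IsAdmissibleSymbol A) {ω : Space n} (hω : ω ≠ 0) {s t : ℝ}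
    (hst : s ≤ t) :
    ‖matEnd (A t ω) - matEnd (A s ω)‖ ≤ symbolVar A ω t - symbolVar A ω s := by
  rw [hA.symbolVar_sub hω, ← matEnd_sub]
  refine (norm_matEnd_le _).trans (mul_le_mul_of_nonneg_left ?_ matConst_nonneg)
  refine Finset.sum_le_sum fun i _ => Finset.sum_le_sum fun j _ => ?_
  exact norm_sub_le_integral_norm_deriv (hA.locallyLipschitz ω hω i j)
    (hA.integrable_deriv ω hω i j) hst

theorem exists_var_le (hA : IsAdmissibleSymbol A) : ∃ M : ℝ, ∀ ω : Space n, ‖ω‖ = 1 → ∀ s t,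
    symbolVar A ω t - symbolVar A ω s ≤ M := by
  obtain ⟨M, hM⟩ := hA.bound
  refine ⟨matConst m * ∑ _i : Fin m, ∑ _j : Fin m, M, fun ω hω s t => ?_⟩
  have hω0 : ω ≠ 0 := by rintro rfl; simp at hω
  rw [hA.symbolVar_sub hω0]
  refine mul_le_mul_of_nonneg_left (Finset.sum_le_sum fun i _ => Finset.sum_le_sum fun j _ => ?_)
    matConst_nonneg
  refine le_trans ?_ (hM ω hω i j)
  refine (le_abs_self _).trans ?_
  rw [intervalIntegral.abs_intervalIntegral_eq, abs_of_nonneg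
    (setIntegral_nonneg measurableSet_uIoc fun _ _ => norm_nonneg _)]
  exact setIntegral_le_integral (hA.integrable_deriv ω hω0 i j).norm
    (Eventually.of_forall fun _ => norm_nonneg _)

/-- The symbol is bounded on the unit sphere uniformly in time: it is so at time `0` by compactness,
and its variation in time is bounded. -/
theorem exists_norm_le (hA : IsAdmissibleSymbol A) : ∃ K₀ : ℝ, 0 ≤ K₀ ∧
    ∀ t, ∀ ω : Space n, ‖ω‖ = 1 → ‖matEnd (A t ω)‖ ≤ K₀ := by
  obtain ⟨M, hM⟩ := hA.exists_var_le
  have hsph : ∀ i j, ∃ C, ∀ ω ∈ Metric.sphere (0 : Space n) 1, ‖A 0 ω i j‖ ≤ C := fun i j =>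
    (isCompact_sphere (0 : Space n) 1).exists_bound_of_continuousOn
      ((hA.continuousOn 0 i j).mono fun ω hω => by
        rintro rfl
        simp at hω)
  choose C hC using hsph
  set K₀ : ℝ := matConst m * ∑ i, ∑ j, C i j + M with hK
  refine ⟨|K₀|, abs_nonneg _, fun t ω hω => le_trans ?_ (le_abs_self _)⟩
  have hω0 : ω ≠ 0 := by rintro rfl; simp at hω
  have h0 : ‖matEnd (A 0 ω)‖ ≤ matConst m * ∑ i, ∑ j, C i j :=
    (norm_matEnd_le _).trans (mul_le_mul_of_nonneg_left (Finset.sum_le_sum fun i _ =>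
      Finset.sum_le_sum fun j _ => hC i j ω (by simpa using hω)) matConst_nonneg)
  have h1 : ‖matEnd (A t ω) - matEnd (A 0 ω)‖ ≤ M := by
    rcases le_total 0 t with ht | ht
    · exact (hA.norm_matEnd_sub_le hω0 ht).trans (hM ω hω _ _)
    · rw [norm_sub_rev]
      exact (hA.norm_matEnd_sub_le hω0 ht).trans (hM ω hω _ _)
  have h2 := norm_le_norm_add_norm_sub' (matEnd (A t ω)) (matEnd (A 0 ω))
  linarith

/-- The symbol along each frequency of the unit sphere is a spectral path, with constants independent
of the frequency. -/
theorem exists_isSpectralPath (hA : IsAdmissibleSymbol A) (hφ : IsRegularlyHyperbolic A φ) :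
    ∃ K d M : ℝ, 0 ≤ K ∧ ∀ ω : Space n, ‖ω‖ = 1 →
      IsSpectralPath (fun t => matEnd (A t ω)) (fun j t => φ j t ω)
        (fun j t => spectralProj (matEnd (A t ω)) (fun j => φ j t ω) j) (symbolVar A ω) K d M ∧
      ∀ j t, spectralProj (matEnd (A t ω)) (fun j => φ j t ω) j ≠ 0 := by
  obtain ⟨K₀, hK₀, hK⟩ := hA.exists_norm_le
  obtain ⟨M, hM⟩ := hA.exists_var_le
  obtain ⟨d, hd, hsep⟩ := hφ.separated
  refine ⟨(2 * K₀ / d) ^ (Fintype.card (Fin m) - 1), d, M, by positivity, fun ω hω => ?_⟩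
  have hω0 : ω ≠ 0 := by rintro rfl; simp at hω
  have hinj : ∀ t, Function.Injective fun j => φ j t ω := by
    intro t i k hik
    by_contra hne
    have h1 := hsep t ω hω i k hne
    have h0 : φ i t ω = φ k t ω := hik
    rw [h0, sub_self, abs_zero] at h1
    linarith
  have hspec : ∀ j t, ((φ j t ω : ℝ) : ℂ) ∈ spectrum ℂ (matEnd (A t ω)) := by
    intro j t
    rw [spectrum_matEnd, Matrix.mem_spectrum_iff_isRoot_charpoly, hφ.charpoly_eq t ω hω0,
      Polynomial.IsRoot, Polynomial.eval_prod]
    exact Finset.prod_eq_zero (Finset.mem_univ j) (by simp)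
  have hroot : ∀ j t, |φ j t ω| ≤ K₀ := by
    intro j t
    have h1 := spectrum.norm_le_norm_mul_of_mem (hspec j t)
    rw [Complex.norm_real, Real.norm_eq_abs] at h1
    refine h1.trans ?_
    have := mul_le_mul (hK t ω hω) (norm_one_endC_le (m := m)) (norm_nonneg _) hK₀
    linarith
  have hvc : ∀ i j, Integrable (fun x => ‖deriv (fun s => A s ω i j) x‖) := fun i j =>
    (hA.integrable_deriv ω hω0 i j).norm
  have hmono : Monotone (symbolVar A ω) := by
    intro s t hst
    have := (norm_nonneg _).trans (hA.norm_matEnd_sub_le hω0 hst)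
    linarith
  refine ⟨{ resolution := fun t => ?_, norm_proj_le := fun j t => ?_, pos := hd,
            separated := fun t => hsep t ω hω
            continuous_root := fun j => hφ.continuous j ω hω0
            continuous_var := ?_, monotone_var := hmono, var_le := fun s t => hM ω hω s t,
            norm_sub_le := fun s t => ?_ }, fun j t => spectralProj_ne_zero (hinj t) (hspec j t)⟩
  · refine isSpectralResolution_spectralProj (hinj t) ?_ fun h => ?_
    · rw [← hφ.charpoly_eq t ω hω0]
      exact aeval_matEnd_charpoly _
    · exact ⟨fun a b => ContinuousLinearMap.ext fun x =>
        PiLp.ext fun i => (h.false i).elim⟩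
  · exact norm_spectralProj_le hd (hsep t ω hω) (hK t ω hω) norm_one_endC_le
      (fun j => hroot j t) j
  · refine continuous_const.mul (continuous_finsetSum _ fun i _ => continuous_finsetSum _
      fun j _ => ?_)
    exact intervalIntegral.continuous_primitive (fun _ _ => (hvc i j).intervalIntegrable) 0
  · rcases le_total s t with hst | hst
    · exact (hA.norm_matEnd_sub_le hω0 hst).trans (le_abs_self _)
    · rw [norm_sub_rev, abs_sub_comm]
      exact (hA.norm_matEnd_sub_le hω0 hst).trans (le_abs_self _)

theorem continuous_symbolGen (hA : IsAdmissibleSymbol A) (ξ : Space n) :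
    Continuous fun t => symbolGen (A t) ξ := by
  by_cases hξ : ξ = 0
  · simp only [hξ, symbolGen_zero]; exact continuous_const
  · simp only [symbolGen_of_ne _ hξ]
    suffices h : Continuous fun t => matEnd (A t ((2 * Real.pi) • ξ)) from
      h.const_smul Complex.I
    refine continuous_iff_continuousAt.2 fun s => tendsto_matEnd fun i j => ?_
    exact (hA.locallyLipschitz _ (by simp [hξ, Real.pi_ne_zero]) i j).continuous.tendsto s

theorem tendsto_symbolGen {e : TimeEnd} {Alim : Space n → Matrix (Fin m) (Fin m) ℂ}
    (hlim : ∀ ξ : Space n, ξ ≠ 0 → ∀ i j,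
      Tendsto (fun t => A t ξ i j) e.limit (𝓝 (Alim ξ i j))) (ξ : Space n) :
    Tendsto (fun t => symbolGen (A t) ξ) e.limit (𝓝 (symbolGen Alim ξ)) := by
  by_cases hξ : ξ = 0
  · simp only [hξ, symbolGen_zero]; exact tendsto_const_nhds
  · simp only [symbolGen_of_ne _ hξ]
    exact (tendsto_matEnd fun i j => hlim _ (by simp [hξ, Real.pi_ne_zero]) i j).const_smul _

theorem exists_norm_symbolGen_le (hA : IsAdmissibleSymbol A) :
    ∃ L : ℝ, 0 ≤ L ∧ ∀ t ξ, ‖symbolGen (A t) ξ‖ ≤ L * ‖ξ‖ := by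
  obtain ⟨K₀, hK₀, hK⟩ := hA.exists_norm_le
  refine ⟨2 * Real.pi * K₀, by positivity, fun t ξ => ?_⟩
  by_cases hξ : ξ = 0
  · simp [hξ, symbolGen_zero]
  · rw [symbolGen_eq (hA.homogeneous t) hξ, norm_smul, norm_mul, Complex.norm_I, one_mul,
      Complex.norm_real, Real.norm_of_nonneg (by positivity)]
    have := hK t _ (norm_unit hξ)
    calc 2 * Real.pi * ‖ξ‖ * ‖matEnd (A t (‖ξ‖⁻¹ • ξ))‖ ≤ 2 * Real.pi * ‖ξ‖ * K₀ := by gcongr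
      _ = _ := by ring

theorem homogeneous_limit (hA : IsAdmissibleSymbol A) {e : TimeEnd}
    {Alim : Space n → Matrix (Fin m) (Fin m) ℂ}
    (hlim : ∀ ξ : Space n, ξ ≠ 0 → ∀ i j,
      Tendsto (fun t => A t ξ i j) e.limit (𝓝 (Alim ξ i j)))
    (c : ℝ) (hc : 0 < c) (ξ : Space n) (hξ : ξ ≠ 0) : Alim (c • ξ) = (c : ℂ) • Alim ξ := by
  ext i j
  refine tendsto_nhds_unique (hlim (c • ξ) (by simp [hξ, hc.ne']) i j) ?_
  simp only [hA.homogeneous _ c hc ξ hξ, Matrix.smul_apply]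
  exact (hlim ξ hξ i j).const_smul _

/-- The propagators of `D_t - A(t,ξ)` and of `D_t - A_±(ξ)` form a wave pair, with a constant which
does not depend on the frequency: by homogeneity it is determined by the symbol on the unit
sphere. -/
theorem exists_isWavePair (hA : IsAdmissibleSymbol A) (hφ : IsRegularlyHyperbolic A φ)
    {e : TimeEnd} {Alim : Space n → Matrix (Fin m) (Fin m) ℂ} {φlim : Fin m → Space n → ℝ}
    (hφlim : IsRegularlyHyperbolic (fun _ => Alim) (fun j _ ξ => φlim j ξ))
    (hlim : ∀ ξ : Space n, ξ ≠ 0 → ∀ i j,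
      Tendsto (fun t => A t ξ i j) e.limit (𝓝 (Alim ξ i j)))
    (hint : ∀ ξ : Space n, ξ ≠ 0 → ∀ j, ∃ θ : ℝ,
      Tendsto (fun t => ∫ s in (0 : ℝ)..t, (φ j s ξ - φlim j ξ)) e.limit (𝓝 θ)) :
    ∃ C : ℝ, ∀ ξ : Space n, IsWavePair e C (fun t => dyson (fun t => symbolGen (A t)) t ξ)
      (fun t => dyson (fun _ => symbolGen Alim) t ξ) := by
  obtain ⟨K, d, M, hK, hpath⟩ := hA.exists_isSpectralPath hφ
  obtain ⟨L, hL0, hL⟩ := hA.exists_norm_symbolGen_le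
  obtain ⟨dl, hdl, hsepl⟩ := hφlim.separated
  refine ⟨max (IsSpectralPath.waveConst (EndC m) (Fin m) K d M) 1, fun ξ => ?_⟩
  by_cases hξ : ξ = 0
  -- At the zero frequency the generators vanish and both propagators are `1`.
  · have hz : ∀ (B : ℝ → Space n → Matrix (Fin m) (Fin m) ℂ) (t : ℝ),
        dyson (fun t => symbolGen (B t)) t ξ = 1 := by
      intro B t
      rw [dyson, tsum_eq_single 0]
      · rfl
      · rintro (_ | k) hk
        · exact absurd rfl hk
        · simp [dysonTerm, hξ, symbolGen_zero]
    simp only [hz A, hz fun _ => Alim]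
    exact isWavePair_one ((norm_one_endC_le).trans (le_max_right _ _))
  · have hω := norm_unit hξ
    have hω0 : ‖ξ‖⁻¹ • ξ ≠ 0 := by simp [hξ]
    obtain ⟨hp, hp0⟩ := hpath _ hω
    have hinj : Function.Injective fun j => φlim j (‖ξ‖⁻¹ • ξ) := by
      intro i k hik
      by_contra hne
      have h1 := hsepl 0 _ hω i k hne
      have h0 : φlim i (‖ξ‖⁻¹ • ξ) = φlim k (‖ξ‖⁻¹ • ξ) := hik
      rw [h0, sub_self, abs_zero] at h1
      linarith
    have hLlim : ‖symbolGen Alim ξ‖ ≤ L * ‖ξ‖ :=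
      le_of_tendsto' (tendsto_symbolGen hlim ξ).norm fun t => hL t ξ
    refine (hp.wave_estimates hK hp0 e hinj
      (tendsto_matEnd fun i j => hlim _ hω0 i j) (fun j => hint _ hω0 j)
      (r := 2 * Real.pi * ‖ξ‖) (Y := fun t => dyson (fun t => symbolGen (A t)) t ξ)
      (Z := fun t => dyson (fun _ => symbolGen Alim) t ξ) (fun t => ?_) dyson_zero
      (fun t => ?_) dyson_zero).mono (le_max_left _ _)
    · have := hasDerivAt_dyson (G := fun t => symbolGen (A t)) (hA.continuous_symbolGen ξ)
        (fun t => hL t ξ) t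
      rwa [symbolGen_eq (hA.homogeneous t) hξ, smul_mul_assoc] at this
    · have := hasDerivAt_dyson (G := fun _ => symbolGen Alim) (x := ξ) continuous_const
        (fun _ => hLlim) t
      rwa [symbolGen_eq (hA.homogeneous_limit hlim) hξ, smul_mul_assoc] at this

end IsAdmissibleSymbol

end SymbolPath

/-! ### Multiplication operators on vector valued square integrable functions -/

section Multiplier

variable {n m : ℕ}

/-- A measurable function of the frequency with values in `End(ℂᵐ)`, bounded by `C`. -/
structure IsBddSymbol (B : Space n → EndC m) (C : ℝ) : Prop where
  stronglyMeasurable : StronglyMeasurable B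
  norm_le : ∀ ξ, ‖B ξ‖ ≤ C

namespace IsBddSymbol

variable {B B' : Space n → EndC m} {C C' : ℝ}

theorem nonneg (h : IsBddSymbol B C) : 0 ≤ C := (norm_nonneg _).trans (h.norm_le 0)

theorem mul (h : IsBddSymbol B C) (h' : IsBddSymbol B' C') :
    IsBddSymbol (fun ξ => B ξ * B' ξ) (C * C') where
  stronglyMeasurable := h.stronglyMeasurable.mul h'.stronglyMeasurable
  norm_le ξ := (norm_mul_le _ _).trans
    (mul_le_mul (h.norm_le ξ) (h'.norm_le ξ) (norm_nonneg _) h.nonneg)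

theorem one : IsBddSymbol (fun _ : Space n => (1 : EndC m)) 1 :=
  ⟨stronglyMeasurable_const, fun _ => norm_one_endC_le⟩

end IsBddSymbol

theorem aestronglyMeasurable_apply {B : Space n → EndC m} (hB : StronglyMeasurable B)
    (f : L2Vec n m) : AEStronglyMeasurable (fun ξ => B ξ (f ξ)) volume :=
  (ContinuousLinearMap.id ℂ (EndC m)).aestronglyMeasurable_comp₂ hB.aestronglyMeasurable
    (Lp.aestronglyMeasurable f)

theorem IsBddSymbol.memLp {B : Space n → EndC m} {C : ℝ} (h : IsBddSymbol B C) (f : L2Vec n m) :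
    MemLp (fun ξ => B ξ (f ξ)) 2 volume :=
  (Lp.memLp f).of_le_mul (aestronglyMeasurable_apply h.stronglyMeasurable f)
    (Eventually.of_forall fun ξ => (B ξ).le_of_opNorm_le (h.norm_le ξ) (f ξ))

open Classical in
/-- The Fourier side multiplication operator by `B` on `(L²)ᵐ`, with the junk value `0` unless `B`
is measurable and bounded. -/
noncomputable def mulL2 (B : Space n → EndC m) : L2Vec n m →L[ℂ] L2Vec n m :=
  if h : ∃ C, IsBddSymbol B C then
    LinearMap.mkContinuous
      { toFun := fun f => (h.choose_spec.memLp f).toLp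
        map_add' := fun f g => by
          rw [← MemLp.toLp_add]
          refine MemLp.toLp_congr _ _ ?_
          filter_upwards [Lp.coeFn_add f g] with ξ hξ
          rw [hξ, Pi.add_apply, map_add]
          rfl
        map_smul' := fun c f => by
          rw [RingHom.id_apply, ← MemLp.toLp_const_smul]
          refine MemLp.toLp_congr _ _ ?_
          filter_upwards [Lp.coeFn_smul c f] with ξ hξ
          rw [hξ, Pi.smul_apply, map_smul]
          rfl }
      h.choose fun f => by
        refine Lp.norm_le_mul_norm_of_ae_le_mul ?_
        filter_upwards [(h.choose_spec.memLp f).coeFn_toLp] with ξ hξ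
        change ‖(h.choose_spec.memLp f).toLp _ ξ‖ ≤ _
        rw [hξ]
        exact (B ξ).le_of_opNorm_le (h.choose_spec.norm_le ξ) (f ξ)
  else 0

namespace IsBddSymbol

variable {B B' : Space n → EndC m} {C C' : ℝ}

theorem coeFn_mulL2 (h : IsBddSymbol B C) (f : L2Vec n m) :
    mulL2 B f =ᵐ[volume] fun ξ => B ξ (f ξ) := by
  have hex : ∃ C, IsBddSymbol B C := ⟨C, h⟩
  rw [mulL2, dif_pos hex]
  exact (hex.choose_spec.memLp f).coeFn_toLp

theorem norm_mulL2_le (h : IsBddSymbol B C) (f : L2Vec n m) : ‖mulL2 B f‖ ≤ C * ‖f‖ := by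
  refine Lp.norm_le_mul_norm_of_ae_le_mul ?_
  filter_upwards [h.coeFn_mulL2 f] with ξ hξ
  rw [hξ]
  exact (B ξ).le_of_opNorm_le (h.norm_le ξ) (f ξ)

theorem mulL2_mulL2 (h : IsBddSymbol B C) (h' : IsBddSymbol B' C') (f : L2Vec n m) :
    mulL2 B (mulL2 B' f) = mulL2 (fun ξ => B ξ * B' ξ) f := by
  refine Lp.ext ?_
  filter_upwards [h.coeFn_mulL2 (mulL2 B' f), h'.coeFn_mulL2 f, (h.mul h').coeFn_mulL2 f]
    with ξ h1 h2 h3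
  rw [h1, h2, h3]
  rfl

end IsBddSymbol

theorem mulL2_one (f : L2Vec n m) : mulL2 (fun _ => 1) f = f := by
  refine Lp.ext ?_
  filter_upwards [IsBddSymbol.one.coeFn_mulL2 f] with ξ h1
  rw [h1]
  rfl

theorem norm_sq_eq_integral (f : L2Vec n m) : ‖f‖ ^ 2 = ∫ ξ, ‖f ξ‖ ^ 2 := by
  have h1 : (inner ℂ f f : ℂ) = ((‖f‖ : ℂ)) ^ 2 := inner_self_eq_norm_sq_to_K f
  have h2 : (inner ℂ f f : ℂ) = ((∫ ξ, ‖f ξ‖ ^ 2 : ℝ) : ℂ) := by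
    rw [L2.inner_def, ← integral_complex_ofReal]
    refine integral_congr_ae (Eventually.of_forall fun ξ => ?_)
    simp
  rw [h1] at h2
  exact_mod_cast h2

theorem integrable_norm_sq (f : L2Vec n m) : Integrable fun ξ => ‖f ξ‖ ^ 2 :=
  (memLp_two_iff_integrable_sq_norm (Lp.aestronglyMeasurable f)).1 (Lp.memLp f)

/-- Dominated convergence for multiplication operators. -/
theorem tendsto_mulL2 {α : Type*} {l : Filter α} [l.IsCountablyGenerated]
    {B : α → Space n → EndC m} {B' : Space n → EndC m} {C : ℝ} (hB : ∀ a, IsBddSymbol (B a) C)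
    (hB' : IsBddSymbol B' C) (h : ∀ ξ, Tendsto (fun a => B a ξ) l (𝓝 (B' ξ))) (f : L2Vec n m) :
    Tendsto (fun a => mulL2 (B a) f) l (𝓝 (mulL2 B' f)) := by
  have hC := hB'.nonneg
  have hdiff : ∀ a, (fun ξ => ‖(mulL2 (B a) f - mulL2 B' f) ξ‖ ^ 2) =ᵐ[volume]
      fun ξ => ‖B a ξ (f ξ) - B' ξ (f ξ)‖ ^ 2 := by
    intro a
    filter_upwards [Lp.coeFn_sub (mulL2 (B a) f) (mulL2 B' f), (hB a).coeFn_mulL2 f,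
      hB'.coeFn_mulL2 f] with ξ h1 h2 h3
    rw [h1, Pi.sub_apply, h2, h3]
  have hlim : Tendsto (fun a => ∫ ξ, ‖B a ξ (f ξ) - B' ξ (f ξ)‖ ^ 2) l
      (𝓝 (∫ _ξ : Space n, (0 : ℝ))) := by
    refine tendsto_integral_filter_of_dominated_convergence
      (fun ξ => (2 * C) ^ 2 * ‖f ξ‖ ^ 2) (Eventually.of_forall fun a => ?_)
      (Eventually.of_forall fun a => Eventually.of_forall fun ξ => ?_)
      ((integrable_norm_sq f).const_mul _) (Eventually.of_forall fun ξ => ?_)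
    · exact ((aestronglyMeasurable_apply (hB a).stronglyMeasurable f).sub
        (aestronglyMeasurable_apply hB'.stronglyMeasurable f)).norm.pow 2
    · rw [Real.norm_of_nonneg (by positivity), ← mul_pow]
      refine pow_le_pow_left₀ (norm_nonneg _) ((norm_sub_le _ _).trans ?_) 2
      have h1 := (B a ξ).le_of_opNorm_le ((hB a).norm_le ξ) (f ξ)
      have h2 := (B' ξ).le_of_opNorm_le (hB'.norm_le ξ) (f ξ)
      linarith
    · have h1 : Tendsto (fun a => B a ξ (f ξ)) l (𝓝 (B' ξ (f ξ))) :=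
        ((ContinuousLinearMap.apply ℂ _ (f ξ)).continuous.tendsto (B' ξ)).comp (h ξ)
      simpa using ((h1.sub_const (B' ξ (f ξ))).norm).pow 2
  rw [integral_zero] at hlim
  rw [tendsto_iff_norm_sub_tendsto_zero]
  have hsq : Tendsto (fun a => ‖mulL2 (B a) f - mulL2 B' f‖ ^ 2) l (𝓝 0) := by
    refine hlim.congr fun a => ?_
    rw [norm_sq_eq_integral]
    exact (integral_congr_ae (hdiff a)).symm
  have := (Real.continuous_sqrt.tendsto 0).comp hsq
  simpa [Function.comp_def, Real.sqrt_sq (norm_nonneg _)] using this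

theorem continuous_mulL2_apply {B : ℝ → Space n → EndC m} {C : ℝ}
    (hB : ∀ t, IsBddSymbol (B t) C) (hc : ∀ ξ, Continuous fun t => B t ξ) {w : ℝ → L2Vec n m}
    (hw : Continuous w) : Continuous fun t => mulL2 (B t) (w t) := by
  refine continuous_iff_continuousAt.2 fun s => ?_
  have h1 : Tendsto (fun t => mulL2 (B t) (w s)) (𝓝 s) (𝓝 (mulL2 (B s) (w s))) :=
    tendsto_mulL2 hB (hB s) (fun ξ => (hc ξ).tendsto s) (w s)
  have h2 : Tendsto (fun t => mulL2 (B t) (w t - w s)) (𝓝 s) (𝓝 0) := by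
    have h3 : Tendsto (fun t => C * ‖w t - w s‖) (𝓝 s) (𝓝 0) := by
      have : Continuous fun t => C * ‖w t - w s‖ := by fun_prop
      simpa using this.tendsto s
    exact squeeze_zero_norm (fun t => (hB t).norm_mulL2_le _) h3
  have := h2.add h1
  simp only [← map_add, sub_add_cancel, zero_add] at this
  exact this

end Multiplier

/-! ### Pairing with test functions -/

section Pairing

variable {n m : ℕ}

/-- The pairing of a vector valued `L²` function with a scalar test function, `w ↦ ∫ η w`. -/
noncomputable def testPairing (η : 𝓢(Space n, ℂ)) : L2Vec n m →L[ℂ] EuclideanSpace ℂ (Fin m) :=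
  (ContinuousLinearMap.lsmul ℂ ℂ (E := EuclideanSpace ℂ (Fin m))).lpPairing volume 2 2 (η.toLp 2)

theorem testPairing_apply (η : 𝓢(Space n, ℂ)) (w : L2Vec n m) :
    testPairing η w = ∫ ξ, η ξ • w ξ := by
  rw [testPairing, ContinuousLinearMap.lpPairing_eq_integral]
  refine integral_congr_ae ?_
  filter_upwards [η.coeFn_toLp 2 volume] with ξ hξ
  rw [hξ]
  rfl

theorem integrable_norm_mul_test (η : 𝓢(Space n, ℂ)) (w : L2Vec n m) :
    Integrable fun ξ => ‖ξ‖ * ‖η ξ‖ * ‖w ξ‖ := by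
  obtain ⟨M, -, hM⟩ := η.decay 0 0
  have hM' : ∀ ξ, ‖η ξ‖ ≤ M := fun ξ => by simpa using hM ξ
  have h1 : MemLp (fun ξ => ‖ξ‖ * ‖η ξ‖) 2 (volume : Measure (Space n)) := by
    have hc : Continuous fun ξ => ‖ξ‖ * ‖η ξ‖ := continuous_norm.mul η.continuous.norm
    rw [memLp_two_iff_integrable_sq hc.aestronglyMeasurable]
    refine ((η.integrable_pow_mul volume 2).const_mul M).mono' (hc.pow 2).aestronglyMeasurable
      (Eventually.of_forall fun ξ => ?_)
    rw [Real.norm_of_nonneg (by positivity)]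
    calc (‖ξ‖ * ‖η ξ‖) ^ 2 = ‖η ξ‖ * (‖ξ‖ ^ 2 * ‖η ξ‖) := by ring
      _ ≤ M * (‖ξ‖ ^ 2 * ‖η ξ‖) := by gcongr; exact hM' ξ
  exact h1.integrable_mul (Lp.memLp w).norm

theorem integrable_test_smul_symbol (η : 𝓢(Space n, ℂ)) {G : Space n → EndC m} {L : ℝ}
    (hG : StronglyMeasurable G) (hL : ∀ ξ, ‖G ξ‖ ≤ L * ‖ξ‖) (w : L2Vec n m) :
    Integrable fun ξ => η ξ • G ξ (w ξ) := by
  refine ((integrable_norm_mul_test η w).const_mul L).mono'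
    (η.continuous.aestronglyMeasurable.smul (aestronglyMeasurable_apply hG w))
    (Eventually.of_forall fun ξ => ?_)
  rw [norm_smul]
  calc ‖η ξ‖ * ‖G ξ (w ξ)‖ ≤ ‖η ξ‖ * (L * ‖ξ‖ * ‖w ξ‖) := by
        gcongr; exact (G ξ).le_of_opNorm_le (hL ξ) (w ξ)
    _ = _ := by ring

theorem integrable_test_smul (η : 𝓢(Space n, ℂ)) {B : Space n → EndC m} {C : ℝ}
    (hB : IsBddSymbol B C) (w : L2Vec n m) : Integrable fun ξ => η ξ • B ξ (w ξ) :=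
  memLp_one_iff_integrable.1 ((hB.memLp w).smul (η.memLp 2 volume))

/-- Parseval's formula for the bilinear pairing of test functions with `L²` functions. -/
theorem testPairing_fourier (χ : 𝓢(Space n, ℂ)) (u : L2Vec n m) :
    ∫ x, χ x • u x = testPairing (𝓕⁻ χ) (𝓕 u : L2Vec n m) := by
  have h1 := congrArg (fun T : 𝓢'(Space n, EuclideanSpace ℂ (Fin m)) => T (𝓕⁻ χ))
    (Lp.fourier_toTemperedDistribution_eq u)
  simp only [TemperedDistribution.fourier_apply, Lp.toTemperedDistribution_apply,
    FourierTransform.fourier_fourierInv_eq] at h1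
  rw [testPairing_apply, ← h1]

end Pairing

/-! ### Distributional solutions on the frequency side -/

section WeakSolutions

open scoped ContDiff

variable {n m : ℕ}

/-- Generators `G(t,ξ)` of frequency side equations `∂ₜ w = G w` of first order: continuous in `t`,
measurable in `ξ` and bounded by `L |ξ|`. -/
structure IsGenerator (G : ℝ → Space n → EndC m) (L : ℝ) : Prop where
  nonneg : 0 ≤ L
  continuous : ∀ ξ, Continuous fun t => G t ξ
  stronglyMeasurable : ∀ t, StronglyMeasurable (G t)
  norm_le : ∀ t ξ, ‖G t ξ‖ ≤ L * ‖ξ‖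

/-- `w` solves `∂ₜ w = G w` on `J`, tested against Schwartz functions of the frequency. -/
def IsFreqSolutionOn (J : Set ℝ) (G : ℝ → Space n → EndC m) (w : ℝ → L2Vec n m) : Prop :=
  ∀ η : 𝓢(Space n, ℂ), ∀ t ∈ J,
    HasDerivAt (fun s => testPairing η (w s)) (∫ ξ, η ξ • G t ξ (w t ξ)) t

/-- The Fourier transform conjugates solutions in the sense of tempered distributions to solutions
of the frequency side equation; the frequency `0` plays no role since it is a null set. -/
theorem isSolutionOn_iff (hn : 0 < n) {J : Set ℝ} {A : ℝ → Space n → Matrix (Fin m) (Fin m) ℂ}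
    {U : ℝ → L2Vec n m} :
    IsSolutionOn J A U ↔ IsFreqSolutionOn J (fun t => symbolGen (A t))
      (fun t => (𝓕 (U t) : L2Vec n m)) := by
  have : Nonempty (Fin n) := ⟨⟨0, hn⟩⟩
  have hne : ∀ᵐ ξ : Space n, ξ ≠ 0 := Measure.ae_ne volume 0
  have key : ∀ (χ : 𝓢(Space n, ℂ)) (t : ℝ), Complex.I • symbolPairing (A t) (U t) χ =
      ∫ ξ, (𝓕⁻ χ) ξ • symbolGen (A t) ξ ((𝓕 (U t) : L2Vec n m) ξ) := by
    intro χ t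
    rw [symbolPairing, ← integral_smul]
    refine integral_congr_ae ?_
    filter_upwards [hne] with ξ hξ
    rw [symbolGen_of_ne _ hξ, smul_apply, smul_comm]
    rfl
  constructor
  · intro h η t ht
    have := h (𝓕 η) t ht
    rw [key] at this
    simpa only [testPairing_fourier, FourierTransform.fourierInv_fourier_eq] using this
  · intro h χ t ht
    rw [key]
    simp only [testPairing_fourier]
    exact h (𝓕⁻ χ) t ht

theorem IsFreqSolutionOn.mono {J J' : Set ℝ} {G : ℝ → Space n → EndC m} {w : ℝ → L2Vec n m}
    (h : IsFreqSolutionOn J G w) (hJ : J' ⊆ J) : IsFreqSolutionOn J' G w :=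
  fun η t ht => h η t (hJ ht)

theorem IsFreqSolutionOn.sub {J : Set ℝ} {G : ℝ → Space n → EndC m} {L : ℝ}
    (hG : IsGenerator G L) {w w' : ℝ → L2Vec n m} (h : IsFreqSolutionOn J G w)
    (h' : IsFreqSolutionOn J G w') : IsFreqSolutionOn J G (fun t => w t - w' t) := by
  intro η t ht
  have := (h η t ht).sub (h' η t ht)
  rw [← integral_sub
    (integrable_test_smul_symbol η (hG.stronglyMeasurable t) (hG.norm_le t) (w t))
    (integrable_test_smul_symbol η (hG.stronglyMeasurable t) (hG.norm_le t) (w' t))] at this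
  convert! this using 1
  · ext1 s
    simp
  · refine integral_congr_ae ?_
    filter_upwards [Lp.coeFn_sub (w t) (w' t)] with ξ hξ
    rw [hξ, Pi.sub_apply, map_sub, smul_sub]

theorem IsGenerator.dyson_stronglyMeasurable {G : ℝ → Space n → EndC m} {L : ℝ}
    (hG : IsGenerator G L) (t : ℝ) : StronglyMeasurable (dyson G t) :=
  stronglyMeasurable_dyson hG.continuous hG.stronglyMeasurable
    (fun ξ => ⟨L * ‖ξ‖, fun t => hG.norm_le t ξ⟩) t

theorem IsGenerator.hasDerivAt_dyson {G : ℝ → Space n → EndC m} {L : ℝ}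
    (hG : IsGenerator G L) (ξ : Space n) (t : ℝ) :
    HasDerivAt (fun t => dyson G t ξ) (G t ξ * dyson G t ξ) t :=
  _root_.hasDerivAt_dyson (hG.continuous ξ) (fun t => hG.norm_le t ξ) t

/-- The propagator provides solutions, by differentiation under the integral sign. -/
theorem IsGenerator.isFreqSolutionOn_mulL2_dyson {G : ℝ → Space n → EndC m} {L C : ℝ}
    (hG : IsGenerator G L) (hC : ∀ t, IsBddSymbol (dyson G t) C) (f : L2Vec n m) (J : Set ℝ) :
    IsFreqSolutionOn J G fun t => mulL2 (dyson G t) f := by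
  intro η t _
  have e1 : (fun s => testPairing η (mulL2 (dyson G s) f)) =
      fun s => ∫ ξ, η ξ • dyson G s ξ (f ξ) := by
    ext1 s
    rw [testPairing_apply]
    refine integral_congr_ae ?_
    filter_upwards [(hC s).coeFn_mulL2 f] with ξ hξ
    rw [hξ]
  have e2 : ∫ ξ, η ξ • G t ξ (mulL2 (dyson G t) f ξ) =
      ∫ ξ, η ξ • (G t ξ * dyson G t ξ) (f ξ) := by
    refine integral_congr_ae ?_
    filter_upwards [(hC t).coeFn_mulL2 f] with ξ hξ
    rw [hξ]
    rfl
  rw [e1, e2]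
  refine (hasDerivAt_integral_of_dominated_loc_of_deriv_le (s := univ)
    (F' := fun s ξ => η ξ • (G s ξ * dyson G s ξ) (f ξ))
    (bound := fun ξ => L * C * (‖ξ‖ * ‖η ξ‖ * ‖f ξ‖)) univ_mem
    (Eventually.of_forall fun s => (integrable_test_smul η (hC s) f).aestronglyMeasurable)
    (integrable_test_smul η (hC t) f) ?_ (Eventually.of_forall fun ξ s _ => ?_)
    ((integrable_norm_mul_test η f).const_mul _) (Eventually.of_forall fun ξ s _ => ?_)).2
  · exact η.continuous.aestronglyMeasurable.smul (aestronglyMeasurable_apply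
      ((hG.stronglyMeasurable t).mul (hG.dyson_stronglyMeasurable t)) f)
  · have h1 : ‖(G s ξ * dyson G s ξ) (f ξ)‖ ≤ L * ‖ξ‖ * C * ‖f ξ‖ := by
      refine (G s ξ * dyson G s ξ).le_of_opNorm_le ((norm_mul_le _ _).trans ?_) (f ξ)
      exact mul_le_mul (hG.norm_le s ξ) ((hC s).norm_le ξ) (norm_nonneg _)
        (mul_nonneg hG.nonneg (norm_nonneg _))
    rw [norm_smul]
    calc ‖η ξ‖ * ‖(G s ξ * dyson G s ξ) (f ξ)‖ ≤ ‖η ξ‖ * (L * ‖ξ‖ * C * ‖f ξ‖) := by gcongr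
      _ = _ := by ring
  · have h1 := hG.hasDerivAt_dyson ξ s
    have h2 : HasDerivAt (fun s => dyson G s ξ (f ξ)) ((G s ξ * dyson G s ξ) (f ξ)) s :=
      ((ContinuousLinearMap.apply ℂ (EuclideanSpace ℂ (Fin m)) (f ξ)).restrictScalars
        ℝ).hasFDerivAt.comp_hasDerivAt s h1
    exact h2.const_smul (η ξ)

theorem eq_zero_of_le_mul_integral {u : ℝ → ℝ} (hu : Continuous u) (hu0 : ∀ t, 0 ≤ u t) {K : ℝ}
    (h : ∀ t, 0 ≤ t → u t ≤ K * ∫ s in (0 : ℝ)..t, u s) {t : ℝ} (ht : 0 ≤ t) : u t = 0 := by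
  have hd : ∀ t, HasDerivAt (fun t => ∫ s in (0 : ℝ)..t, u s) (u t) t := fun t =>
    (hu.integral_hasStrictDerivAt 0 t).hasDerivAt
  have hF := eq_zero_of_abs_deriv_le_mul_abs_self_of_eq_zero_right
    (f := fun t => ∫ s in (0 : ℝ)..t, u s) (f' := u) (K := K) (a := 0) (b := t)
    (fun x _ => (hd x).continuousAt.continuousWithinAt) (fun x _ => (hd x).hasDerivWithinAt)
    (by simp) (fun x hx => by
      rw [Real.norm_of_nonneg (hu0 x), Real.norm_of_nonneg
        (intervalIntegral.integral_nonneg hx.1 fun s _ => hu0 s)]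
      exact h x hx.1) t ⟨ht, le_rfl⟩
  have h1 := h t ht
  rw [hF, mul_zero] at h1
  exact le_antisymm h1 (hu0 t)

theorem TimeEnd.isOpen_halfLine (e : TimeEnd) : IsOpen e.halfLine := by
  cases e
  · exact isOpen_Ioi
  · exact isOpen_Iio

theorem TimeEnd.isPreconnected_halfLine (e : TimeEnd) : IsPreconnected e.halfLine := by
  cases e
  · exact isPreconnected_Ioi
  · exact isPreconnected_Iio

theorem TimeEnd.zero_mem_closure_halfLine (e : TimeEnd) : (0 : ℝ) ∈ closure e.halfLine := by
  cases e <;> simp [TimeEnd.halfLine]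

theorem TimeEnd.halfLine_mem_limit (e : TimeEnd) : e.halfLine ∈ e.limit := by
  cases e
  · exact Ioi_mem_atTop 0
  · exact Iio_mem_atBot 0

/-- Gronwall's lemma on the half line `e`, in integral form. -/
theorem eq_zero_of_norm_le_integral {F : Type*} [NormedAddCommGroup F] {y : ℝ → F}
    (hy : Continuous y) {K : ℝ} (e : TimeEnd)
    (h : ∀ t ∈ e.halfLine, ‖y t‖ ≤ K * |∫ s in (0 : ℝ)..t, ‖y s‖|) (h0 : y 0 = 0)
    {t : ℝ} (ht : t ∈ e.halfLine) : y t = 0 := by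
  cases e with
  | plus =>
    refine norm_eq_zero.1 (eq_zero_of_le_mul_integral hy.norm (fun _ => norm_nonneg _) (K := K)
      (fun t ht => ?_) (le_of_lt ht))
    rcases ht.eq_or_lt with rfl | ht
    · simp [h0]
    · have := h t ht
      rwa [abs_of_nonneg (intervalIntegral.integral_nonneg ht.le fun s _ => norm_nonneg _)] at this
  | minus =>
    have ht' : t < 0 := ht
    have hyn : Continuous fun t => ‖y (-t)‖ := (hy.comp continuous_neg).norm
    have := eq_zero_of_le_mul_integral hyn (fun _ => norm_nonneg _) (K := K)
      (fun t ht => ?_) (neg_nonneg.2 ht'.le)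
    · simpa using this
    · rcases ht.eq_or_lt with rfl | ht
      · simp [h0]
      · have := h (-t) (neg_lt_zero.2 ht)
        rw [intervalIntegral.integral_symm, abs_neg, abs_of_nonneg
          (intervalIntegral.integral_nonneg (neg_nonpos.2 ht.le) fun s _ => norm_nonneg _)] at this
        rwa [intervalIntegral.integral_comp_neg (fun s => ‖y s‖), neg_zero]

/-- Restriction of a symbol to the ball of radius `R`. -/
noncomputable def cutoff (R : ℝ) (B : Space n → EndC m) : Space n → EndC m :=
  (Metric.ball 0 R).indicator B

theorem IsGenerator.isBddSymbol_cutoff {G : ℝ → Space n → EndC m} {L : ℝ} (hG : IsGenerator G L)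
    {R : ℝ} (hR : 0 ≤ R) (t : ℝ) : IsBddSymbol (cutoff R (G t)) (L * R) where
  stronglyMeasurable := (hG.stronglyMeasurable t).indicator measurableSet_ball
  norm_le ξ := by
    by_cases hξ : ξ ∈ Metric.ball (0 : Space n) R
    · rw [cutoff, indicator_of_mem hξ]
      exact (hG.norm_le t ξ).trans
        (mul_le_mul_of_nonneg_left (mem_ball_zero_iff.1 hξ).le hG.nonneg)
    · rw [cutoff, indicator_of_notMem hξ, norm_zero]
      exact mul_nonneg hG.nonneg hR

theorem isBddSymbol_cutoff_one (R : ℝ) : IsBddSymbol (cutoff (n := n) (m := m) R fun _ => 1) 1 where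
  stronglyMeasurable := stronglyMeasurable_const.indicator measurableSet_ball
  norm_le ξ := by
    by_cases hξ : ξ ∈ Metric.ball (0 : Space n) R
    · rw [cutoff, indicator_of_mem hξ]; exact norm_one_endC_le
    · rw [cutoff, indicator_of_notMem hξ, norm_zero]; exact zero_le_one

/-- A square integrable function which pairs to zero with the test functions supported in a ball
vanishes on that ball. -/
theorem mulL2_cutoff_eq_zero {R : ℝ} {f : L2Vec n m}
    (h : ∀ η : 𝓢(Space n, ℂ), tsupport η ⊆ Metric.ball 0 R → testPairing η f = 0) :
    mulL2 (cutoff R fun _ => 1) f = 0 := by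
  have hae := Metric.isOpen_ball.ae_eq_zero_of_integral_contDiff_smul_eq_zero
    (U := Metric.ball (0 : Space n) R) (f := f) (μ := volume)
    (((Lp.memLp f).locallyIntegrable (by norm_num)).locallyIntegrableOn _) (by
      intro g hg hgc hgs
      have hg₁ : HasCompactSupport (Complex.ofRealCLM ∘ g) := hgc.comp_left rfl
      have hg₂ : ContDiff ℝ ∞ (Complex.ofRealCLM ∘ g) := by fun_prop
      have h1 := h (hg₁.toSchwartzMap hg₂) ((closure_mono (fun x hx => ?_)).trans hgs)
      · rw [testPairing_apply] at h1
        simpa using h1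
      · intro h0
        exact hx (by simp [h0]))
  rw [Lp.eq_zero_iff_ae_eq_zero]
  filter_upwards [hae, (isBddSymbol_cutoff_one R).coeFn_mulL2 f] with ξ h1 h2
  rw [h2, cutoff]
  by_cases hξ : ξ ∈ Metric.ball (0 : Space n) R
  · rw [h1 hξ, map_zero]; rfl
  · rw [indicator_of_notMem hξ]; rfl

/-- Uniqueness for the frequency side equation: a solution on a half line which vanishes at time
`0` vanishes. On each ball of frequencies the equation becomes an ordinary differential equation in
`L²` with bounded coefficients, to which Gronwall's lemma applies. -/
theorem IsFreqSolutionOn.eq_zero {G : ℝ → Space n → EndC m} {L : ℝ} (hG : IsGenerator G L)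
    {e : TimeEnd} {w : ℝ → L2Vec n m} (hw : IsFreqSolutionOn e.halfLine G w) (hwc : Continuous w)
    (hw0 : w 0 = 0) {t : ℝ} (ht : t ∈ e.halfLine) : w t = 0 := by
  have hball : ∀ R : ℝ, 0 ≤ R → mulL2 (cutoff R fun _ => 1) (w t) = 0 := by
    intro R hR
    set E : L2Vec n m →L[ℂ] L2Vec n m := mulL2 (cutoff R fun _ => 1) with hE
    set T : ℝ → L2Vec n m →L[ℂ] L2Vec n m := fun t => mulL2 (cutoff R (G t)) with hT
    have hb := fun t => hG.isBddSymbol_cutoff hR t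
    have hTE : ∀ s f, T s (E f) = T s f := by
      intro s f
      rw [hT, hE, (hb s).mulL2_mulL2 (isBddSymbol_cutoff_one R)]
      congr 2
      ext1 ξ
      by_cases hξ : ξ ∈ Metric.ball (0 : Space n) R <;> simp [cutoff, hξ]
    have hET : ∀ s f, E (T s f) = T s f := by
      intro s f
      rw [hT, hE, (isBddSymbol_cutoff_one R).mulL2_mulL2 (hb s)]
      congr 2
      ext1 ξ
      by_cases hξ : ξ ∈ Metric.ball (0 : Space n) R <;> simp [cutoff, hξ]
    have hcont : Continuous fun s => T s (w s) := by
      refine continuous_mulL2_apply hb (fun ξ => ?_) hwc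
      by_cases hξ : ξ ∈ Metric.ball (0 : Space n) R
      · simpa [cutoff, hξ] using hG.continuous ξ
      · simpa [cutoff, hξ] using continuous_const
    have hI : ∀ s, HasDerivAt (fun s => ∫ τ in (0 : ℝ)..s, T τ (w τ)) (T s (w s)) s := fun s =>
      (hcont.integral_hasStrictDerivAt 0 s).hasDerivAt
    -- `q` is the defect in the integrated equation; it is constant on the half line when tested
    -- against functions supported in the ball.
    set q : ℝ → L2Vec n m := fun s => w s - ∫ τ in (0 : ℝ)..s, T τ (w τ) with hq
    have hqc : Continuous q := hwc.sub (continuous_iff_continuousAt.2 fun s => (hI s).continuousAt)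
    have hqd : ∀ η : 𝓢(Space n, ℂ), tsupport η ⊆ Metric.ball 0 R → ∀ s ∈ e.halfLine,
        HasDerivAt (fun s => testPairing η (q s)) 0 s := by
      intro η hη s hs
      have h1 : HasDerivAt (fun s => testPairing η (∫ τ in (0 : ℝ)..s, T τ (w τ)))
          (testPairing η (T s (w s))) s :=
        ((testPairing η).restrictScalars ℝ).hasFDerivAt.comp_hasDerivAt s (hI s)
      have h2 := (hw η s hs).sub h1
      convert! h2 using 1
      · ext1 s
        simp [hq]
      · rw [eq_comm, sub_eq_zero, testPairing_apply]
        refine integral_congr_ae ?_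
        filter_upwards [(hb s).coeFn_mulL2 (w s)] with ξ hξ
        rw [hT, hξ]
        by_cases hξR : ξ ∈ Metric.ball (0 : Space n) R
        · simp [cutoff, hξR]
        · have : η ξ = 0 := image_eq_zero_of_notMem_tsupport fun h => hξR (hη h)
          rw [this, zero_smul, zero_smul]
    have hqE : ∀ s ∈ e.halfLine, ∀ s' ∈ e.halfLine, E (q s) = E (q s') := by
      intro s hs s' hs'
      rw [← sub_eq_zero, ← map_sub]
      refine mulL2_cutoff_eq_zero fun η hη => ?_
      rw [map_sub, sub_eq_zero]
      exact e.isOpen_halfLine.is_const_of_deriv_eq_zero e.isPreconnected_halfLine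
        (fun x hx => (hqd η hη x hx).differentiableAt.differentiableWithinAt)
        (fun x hx => (hqd η hη x hx).deriv) hs hs'
    have hEq : ∀ s ∈ e.halfLine, E (q s) = 0 := by
      intro s hs
      have hcl : IsClosed {x | E (q s) = E (q x)} :=
        isClosed_eq continuous_const (E.continuous.comp hqc)
      have := closure_minimal (fun x hx => hqE s hs x hx) hcl e.zero_mem_closure_halfLine
      have h0 : E (q s) = E (q 0) := this
      rw [h0]
      simp [hq, hw0]
    have hy : Continuous fun s => E (w s) := E.continuous.comp hwc
    refine eq_zero_of_norm_le_integral hy (K := L * R) e (fun s hs => ?_) (by simp [hw0]) ht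
    have h1 : E (w s) = ∫ τ in (0 : ℝ)..s, T τ (E (w τ)) := by
      have h2 := hEq s hs
      rw [hq] at h2
      simp only [map_sub, sub_eq_zero] at h2
      rw [h2, ← ContinuousLinearMap.intervalIntegral_comp_comm _
        (hcont.intervalIntegrable 0 s)]
      simp only [hET, hTE]
    have h3 : ‖∫ τ in (0 : ℝ)..s, T τ (E (w τ))‖ ≤ |∫ τ in (0 : ℝ)..s, L * R * ‖E (w τ)‖| :=
      intervalIntegral.norm_integral_le_abs_of_norm_le
        (Eventually.of_forall fun τ => (hb τ).norm_mulL2_le _)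
        ((continuous_const.mul hy.norm).intervalIntegrable _ _)
    rw [intervalIntegral.integral_const_mul, abs_mul,
      abs_of_nonneg (mul_nonneg hG.nonneg hR)] at h3
    rwa [← h1] at h3
  rw [Lp.eq_zero_iff_ae_eq_zero]
  have hall : ∀ᵐ ξ : Space n, ∀ N : ℕ, cutoff (n := n) (m := m) N (fun _ => 1) ξ (w t ξ) = 0 := by
    rw [ae_all_iff]
    intro N
    have h1 := hball N (Nat.cast_nonneg N)
    rw [Lp.eq_zero_iff_ae_eq_zero] at h1
    filter_upwards [h1, (isBddSymbol_cutoff_one N).coeFn_mulL2 (w t)] with ξ h2 h3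
    rw [← h3, h2]
    rfl
  filter_upwards [hall] with ξ hξ
  obtain ⟨N, hN⟩ := exists_nat_gt ‖ξ‖
  have h1 := hξ N
  rw [cutoff, indicator_of_mem (mem_ball_zero_iff.2 hN)] at h1
  exact h1

theorem continuous_mulL2_dyson {G : ℝ → Space n → EndC m} {L C : ℝ} (hG : IsGenerator G L)
    (hC : ∀ t, IsBddSymbol (dyson G t) C) (f : L2Vec n m) :
    Continuous fun t => mulL2 (dyson G t) f :=
  continuous_mulL2_apply hC
    (fun ξ => continuous_iff_continuousAt.2 fun t => (hG.hasDerivAt_dyson ξ t).continuousAt)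
    continuous_const

/-- The solutions on a half line are given by the propagator. -/
theorem IsFreqSolutionOn.eq_mulL2_dyson {G : ℝ → Space n → EndC m} {L C : ℝ}
    (hG : IsGenerator G L) (hC : ∀ t, IsBddSymbol (dyson G t) C) {e : TimeEnd}
    {w : ℝ → L2Vec n m} (hw : IsFreqSolutionOn e.halfLine G w) (hwc : Continuous w)
    {t : ℝ} (ht : t ∈ e.halfLine) : w t = mulL2 (dyson G t) (w 0) := by
  have h1 := (hw.sub hG (hG.isFreqSolutionOn_mulL2_dyson hC (w 0) e.halfLine)).eq_zero hG
    (hwc.sub (continuous_mulL2_dyson hG hC (w 0))) (by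
      have : dyson G 0 = fun _ => 1 := funext fun ξ => dyson_zero
      rw [this, mulL2_one, sub_self]) ht
  exact sub_eq_zero.1 h1

theorem IsFreqSolutionOn.eq_mulL2_dyson_of_univ {G : ℝ → Space n → EndC m} {L C : ℝ}
    (hG : IsGenerator G L) (hC : ∀ t, IsBddSymbol (dyson G t) C)
    {w : ℝ → L2Vec n m} (hw : IsFreqSolutionOn univ G w) (hwc : Continuous w)
    (t : ℝ) : w t = mulL2 (dyson G t) (w 0) := by
  rcases lt_trichotomy t 0 with ht | rfl | ht
  · exact (hw.mono (subset_univ _)).eq_mulL2_dyson hG hC (e := .minus) hwc ht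
  · have : dyson G 0 = fun _ => 1 := funext fun ξ => dyson_zero
    rw [this, mulL2_one]
  · exact (hw.mono (subset_univ _)).eq_mulL2_dyson hG hC (e := .plus) hwc ht

end WeakSolutions

/-! ### The wave operator -/

section WaveOperator

variable {n m : ℕ}

theorem IsAdmissibleSymbol.exists_isGenerator {A : ℝ → Space n → Matrix (Fin m) (Fin m) ℂ}
    (hA : IsAdmissibleSymbol A) {e : TimeEnd} {Alim : Space n → Matrix (Fin m) (Fin m) ℂ}
    (hlim : ∀ ξ : Space n, ξ ≠ 0 → ∀ i j,
      Tendsto (fun t => A t ξ i j) e.limit (𝓝 (Alim ξ i j))) :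
    ∃ L, IsGenerator (fun t => symbolGen (A t)) L ∧ IsGenerator (fun _ => symbolGen Alim) L := by
  obtain ⟨L, hL0, hL⟩ := hA.exists_norm_symbolGen_le
  have hm : ∀ t, StronglyMeasurable (symbolGen (A t)) := fun t =>
    stronglyMeasurable_symbolGen (hA.continuousOn t)
  have ht := fun ξ => IsAdmissibleSymbol.tendsto_symbolGen hlim ξ
  exact ⟨L, ⟨hL0, hA.continuous_symbolGen, hm, hL⟩, ⟨hL0, fun _ => continuous_const,
    fun _ => stronglyMeasurable_of_tendsto e.limit hm (tendsto_pi_nhds.2 ht),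
    fun _ ξ => le_of_tendsto' (ht ξ).norm fun t => hL t ξ⟩⟩

/-- The propagator of the frequency side equation, transported to the physical side, solves the
original equation for any initial value. -/
theorem exists_solution (hn : 0 < n) {A : ℝ → Space n → Matrix (Fin m) (Fin m) ℂ} {L C : ℝ}
    (hG : IsGenerator (fun t => symbolGen (A t)) L)
    (hC : ∀ t, IsBddSymbol (dyson (fun t => symbolGen (A t)) t) C) (f : L2Vec n m) :
    ∃ U : ℝ → L2Vec n m, Continuous U ∧ IsSolutionOn univ A U ∧ U 0 = f ∧
      ∀ t, (𝓕 (U t) : L2Vec n m) =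
        mulL2 (dyson (fun t => symbolGen (A t)) t) (𝓕 f : L2Vec n m) := by
  have hF : ∀ g : L2Vec n m, (𝓕 (𝓕⁻ g : L2Vec n m) : L2Vec n m) = g := fun g =>
    FourierTransform.fourier_fourierInv_eq g
  refine ⟨fun t => 𝓕⁻ (mulL2 (dyson (fun t => symbolGen (A t)) t) (𝓕 f : L2Vec n m)), ?_, ?_, ?_,
    fun t => hF _⟩
  · exact (Lp.fourierTransformₗᵢ (Space n) (EuclideanSpace ℂ (Fin m))).symm.continuous.comp
      (continuous_mulL2_dyson hG hC _)
  · rw [isSolutionOn_iff hn]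
    simp only [hF]
    exact hG.isFreqSolutionOn_mulL2_dyson hC _ univ
  · have : dyson (fun t => symbolGen (A t)) 0 = fun _ => 1 := funext fun ξ => dyson_zero
    simp only [this, mulL2_one]
    exact FourierTransform.fourierInv_fourier_eq f

theorem continuous_fourier {U : ℝ → L2Vec n m} (hU : Continuous U) :
    Continuous fun t => (𝓕 (U t) : L2Vec n m) :=
  (Lp.fourierTransformₗᵢ (Space n) (EuclideanSpace ℂ (Fin m))).continuous.comp hU

theorem norm_fourier_sub (f g : L2Vec n m) :
    ‖(𝓕 f : L2Vec n m) - (𝓕 g : L2Vec n m)‖ = ‖f - g‖ := by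
  have := (Lp.fourierTransformₗᵢ (Space n) (EuclideanSpace ℂ (Fin m))).norm_map (f - g)
  rw [map_sub] at this
  exact this

theorem fourier_injective : Function.Injective fun f : L2Vec n m => (𝓕 f : L2Vec n m) :=
  (Lp.fourierTransformₗᵢ (Space n) (EuclideanSpace ℂ (Fin m))).injective

/-- The frequency side wave operator is multiplication by `Ω(ξ)⁻¹`, where `Ω(ξ) = lim Z(-t) Y(t)`.
The last conclusion makes it unique: no perturbed evolution but the trivial one tends to zero. -/
theorem exists_wave_multiplier {Y Z : ℝ → Space n → EndC m} {e : TimeEnd} {C : ℝ}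
    (hYm : ∀ t, StronglyMeasurable (Y t)) (hZm : ∀ t, StronglyMeasurable (Z t))
    (h : ∀ ξ, IsWavePair e C (fun t => Y t ξ) (fun t => Z t ξ)) :
    ∃ W : Space n → EndC m, IsBddSymbol W C ∧
      (∀ v : L2Vec n m, Tendsto (fun t => ‖mulL2 (Z t) v - mulL2 (Y t) (mulL2 W v)‖) e.limit
        (𝓝 0)) ∧
      ∀ g : L2Vec n m, Tendsto (fun t => ‖mulL2 (Y t) g‖) e.limit (𝓝 0) → g = 0 := by
  have hY : ∀ t, IsBddSymbol (Y t) C := fun t => ⟨hYm t, fun ξ => (h ξ).norm_le t⟩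
  have hZ : ∀ t, IsBddSymbol (Z t) C := fun t => ⟨hZm t, fun ξ => (h ξ).norm_free_le t⟩
  have hYi : ∀ t, IsBddSymbol (fun ξ => Ring.inverse (Y t ξ)) C := fun t =>
    ⟨stronglyMeasurable_ringInverse (hYm t), fun ξ => (h ξ).norm_inverse_le t⟩
  choose Ω hΩ hΩu hΩn using fun ξ => (h ξ).exists_limit
  have hΩm : StronglyMeasurable Ω := stronglyMeasurable_of_tendsto e.limit
    (fun t => (hZm (-t)).mul (hYm t)) (tendsto_pi_nhds.2 hΩ)
  have hW : IsBddSymbol (fun ξ => Ring.inverse (Ω ξ)) C :=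
    ⟨stronglyMeasurable_ringInverse hΩm, hΩn⟩
  have hC : 0 ≤ C := hW.nonneg
  refine ⟨fun ξ => Ring.inverse (Ω ξ), hW, fun v => ?_, fun g hg => ?_⟩
  · have hX := fun t => ((hZ (-t)).mul (hY t)).mul hW
    have hone : IsBddSymbol (fun _ : Space n => (1 : EndC m)) (max (C * C * C) 1) :=
      ⟨stronglyMeasurable_const, fun _ => norm_one_endC_le.trans (le_max_right _ _)⟩
    have h1 : Tendsto (fun t => mulL2 (fun ξ => Z (-t) ξ * Y t ξ * Ring.inverse (Ω ξ)) v) e.limit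
        (𝓝 (mulL2 (fun _ => 1) v)) := by
      refine tendsto_mulL2 (C := max (C * C * C) 1) (fun t => ⟨(hX t).stronglyMeasurable, fun ξ =>
        ((hX t).norm_le ξ).trans (le_max_left _ _)⟩) hone (fun ξ => ?_) v
      have := (hΩ ξ).mul_const (Ring.inverse (Ω ξ))
      rwa [Ring.mul_inverse_cancel _ (hΩu ξ)] at this
    rw [mulL2_one] at h1
    have h2 : Tendsto (fun t => C * ‖v - mulL2 (fun ξ => Z (-t) ξ * Y t ξ *
        Ring.inverse (Ω ξ)) v‖) e.limit (𝓝 0) := by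
      simpa using ((tendsto_const_nhds (x := v)).sub h1).norm.const_mul C
    refine squeeze_zero (fun _ => norm_nonneg _) (fun t => ?_) h2
    have h3 : mulL2 (Y t) (mulL2 (fun ξ => Ring.inverse (Ω ξ)) v) =
        mulL2 (Z t) (mulL2 (fun ξ => Z (-t) ξ * Y t ξ * Ring.inverse (Ω ξ)) v) := by
      rw [(hZ t).mulL2_mulL2 (hX t), (hY t).mulL2_mulL2 hW]
      congr 2
      ext1 ξ
      rw [← mul_assoc, ← mul_assoc, (h ξ).free_mul_free_neg t, one_mul]
    rw [h3, ← map_sub]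
    exact (hZ t).norm_mulL2_le _
  · have h1 : ∀ t, ‖g‖ ≤ C * ‖mulL2 (Y t) g‖ := by
      intro t
      have h2 : mulL2 (fun ξ => Ring.inverse (Y t ξ)) (mulL2 (Y t) g) = g := by
        rw [(hYi t).mulL2_mulL2 (hY t)]
        have : (fun ξ => Ring.inverse (Y t ξ) * Y t ξ) = fun _ => 1 :=
          funext fun ξ => Ring.inverse_mul_cancel _ ((h ξ).isUnit t)
        rw [this, mulL2_one]
      have h3 := (hYi t).norm_mulL2_le (mulL2 (Y t) g)
      rwa [h2] at h3
    have h2 : ‖g‖ ≤ 0 := ge_of_tendsto' (by simpa using hg.const_mul C) h1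
    exact norm_le_zero_iff.1 h2

end WaveOperator

theorem theorem1p2 {n m : ℕ} (hn : 0 < n) (e : TimeEnd)
    (A : ℝ → Space n → Matrix (Fin m) (Fin m) ℂ)
    (Alim : Space n → Matrix (Fin m) (Fin m) ℂ)
    (φ : Fin m → ℝ → Space n → ℝ)
    (φlim : Fin m → Space n → ℝ)
    (hA : IsAdmissibleSymbol A)
    (hhyp : IsRegularlyHyperbolic A φ)
    (hlimhyp : IsRegularlyHyperbolic (fun _ => Alim) (fun j _ ξ => φlim j ξ))
    (hlim : ∀ ξ : Space n, ξ ≠ 0 → ∀ i j,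
      Tendsto (fun t => A t ξ i j) e.limit (𝓝 (Alim ξ i j)))
    (hint : ∀ ξ : Space n, ξ ≠ 0 → ∀ j, ∃ θ : ℝ,
      Tendsto (fun t => ∫ s in (0 : ℝ)..t, (φ j s ξ - φlim j ξ)) e.limit (𝓝 θ)) :
    (∀ V : ℝ → L2Vec n m, Continuous V → IsSolutionOn e.halfLine (fun _ => Alim) V →
      ∃! U : ℝ → L2Vec n m, Continuous U ∧ IsSolutionOn univ A U ∧
        Tendsto (fun t => ‖V t - U t‖) e.limit (𝓝 0)) ∧
    (∀ f : L2Vec n m, ∃ V : ℝ → L2Vec n m,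
      Continuous V ∧ IsSolutionOn e.halfLine (fun _ => Alim) V ∧ V 0 = f) ∧
    (∃ W : L2Vec n m →L[ℂ] L2Vec n m, ∀ V U : ℝ → L2Vec n m,
      Continuous V → IsSolutionOn e.halfLine (fun _ => Alim) V →
      Continuous U → IsSolutionOn univ A U →
      Tendsto (fun t => ‖V t - U t‖) e.limit (𝓝 0) →
      U 0 = W (V 0)) := by
  obtain ⟨L, hG, hG0⟩ := hA.exists_isGenerator hlim
  obtain ⟨C, hC⟩ := hA.exists_isWavePair hhyp hlimhyp hlim hint
  set Y : ℝ → Space n → EndC m := dyson (fun t => symbolGen (A t)) with hYdef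
  set Z : ℝ → Space n → EndC m := dyson (fun _ => symbolGen Alim) with hZdef
  have hY : ∀ t, IsBddSymbol (Y t) C := fun t =>
    ⟨hG.dyson_stronglyMeasurable t, fun ξ => (hC ξ).norm_le t⟩
  have hZ : ∀ t, IsBddSymbol (Z t) C := fun t =>
    ⟨hG0.dyson_stronglyMeasurable t, fun ξ => (hC ξ).norm_free_le t⟩
  obtain ⟨W, hW, hWlim, hinj⟩ := exists_wave_multiplier (fun t => (hY t).stronglyMeasurable)
    (fun t => (hZ t).stronglyMeasurable) hC
  have hVrep : ∀ V : ℝ → L2Vec n m, Continuous V → IsSolutionOn e.halfLine (fun _ => Alim) V →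
      ∀ t ∈ e.halfLine, (𝓕 (V t) : L2Vec n m) = mulL2 (Z t) (𝓕 (V 0) : L2Vec n m) :=
    fun V hVc hV t ht => ((isSolutionOn_iff hn).1 hV).eq_mulL2_dyson hG0 hZ
      (continuous_fourier hVc) ht
  have hUrep : ∀ U : ℝ → L2Vec n m, Continuous U → IsSolutionOn univ A U →
      ∀ t, (𝓕 (U t) : L2Vec n m) = mulL2 (Y t) (𝓕 (U 0) : L2Vec n m) :=
    fun U hUc hU t => ((isSolutionOn_iff hn).1 hU).eq_mulL2_dyson_of_univ hG hY
      (continuous_fourier hUc) t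
  have hwave : ∀ V U : ℝ → L2Vec n m, Continuous V →
      IsSolutionOn e.halfLine (fun _ => Alim) V → Continuous U → IsSolutionOn univ A U →
      Tendsto (fun t => ‖V t - U t‖) e.limit (𝓝 0) →
      (𝓕 (U 0) : L2Vec n m) = mulL2 W (𝓕 (V 0) : L2Vec n m) := by
    intro V U hVc hV hUc hU hVU
    refine sub_eq_zero.1 (hinj _ ?_)
    have h1 := hVU.add (hWlim (𝓕 (V 0) : L2Vec n m))
    rw [add_zero] at h1
    refine squeeze_zero' (Eventually.of_forall fun _ => norm_nonneg _) ?_ h1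
    filter_upwards [e.halfLine_mem_limit] with t ht
    rw [map_sub, ← hUrep U hUc hU t, ← hVrep V hVc hV t ht, ← norm_fourier_sub (V t) (U t),
      norm_sub_rev (𝓕 (V t) : L2Vec n m) (𝓕 (U t) : L2Vec n m)]
    exact norm_sub_le_norm_sub_add_norm_sub _ _ _
  refine ⟨fun V hVc hV => ?_, fun f => ?_, ?_⟩
  · obtain ⟨U, hUc, hU, hU0, hUF⟩ := exists_solution hn hG hY
      (𝓕⁻ (mulL2 W (𝓕 (V 0) : L2Vec n m)) : L2Vec n m)
    refine ⟨U, ⟨hUc, hU, ?_⟩, ?_⟩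
    · refine (hWlim (𝓕 (V 0) : L2Vec n m)).congr' ?_
      filter_upwards [e.halfLine_mem_limit] with t ht
      have h1 : (𝓕 (𝓕⁻ (mulL2 W (𝓕 (V 0) : L2Vec n m)) : L2Vec n m) : L2Vec n m) =
        mulL2 W (𝓕 (V 0) : L2Vec n m) := FourierTransform.fourier_fourierInv_eq _
      rw [← norm_fourier_sub (V t) (U t), hUF t, hVrep V hVc hV t ht, h1]
    · rintro U' ⟨hUc', hU', hVU'⟩
      have h1 := hwave V U' hVc hV hUc' hU' hVU'
      ext1 t
      apply fourier_injective
      change (𝓕 (U' t) : L2Vec n m) = (𝓕 (U t) : L2Vec n m)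
      rw [hUrep U' hUc' hU' t, hUrep U hUc hU t, h1, hU0]
      exact congrArg _ (FourierTransform.fourier_fourierInv_eq (mulL2 W (𝓕 (V 0)))).symm
  · obtain ⟨V, hVc, hV, hV0, -⟩ := exists_solution hn (A := fun _ => Alim) hG0 hZ f
    refine ⟨V, hVc, ?_, hV0⟩
    exact fun χ t _ => hV χ t (mem_univ t)
  · let F := Lp.fourierTransformₗᵢ (Space n) (EuclideanSpace ℂ (Fin m))
    refine ⟨(F.symm.toContinuousLinearEquiv : L2Vec n m →L[ℂ] L2Vec n m) ∘L mulL2 W ∘L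
      (F.toContinuousLinearEquiv : L2Vec n m →L[ℂ] L2Vec n m),
      fun V U hVc hV hUc hU hVU => ?_⟩
    have h1 : F (U 0) = mulL2 W (F (V 0)) := hwave V U hVc hV hUc hU hVU
    change U 0 = F.symm (mulL2 W (F (V 0)))
    rw [← h1, LinearIsometryEquiv.symm_apply_apply]
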